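/- Let $d\ge 3$ and let $G=\operatorname{Isom}(\mathbb R^d)=\mathbb R^d\rtimes \mathrm{SO}(d)$ be the group of orientation-preserving isometries of $\mathbb R^d$; write $g=(v,\theta)\in G$ for the isometry $gx=v+\theta x$, where $v\in\mathbb R^d$ and $\theta\in\mathrm{SO}(d)$. Let $L^2(\mathrm{SO}(d))$ be the space of complex-valued square-integrable functions with respect to the Haar probability measure, and let $L^2_0(\mathrm{SO}(d))$ be the subspace of functions with mean zero. For $x\in\mathbb R^d$ let $\pi_x$ be the unitary representation of $G$ on $L^2(\mathrm{SO}(d))$ given by $$(\pi_x(g)\varphi)(\omega)=e^{-2\pi i\langle \omega x,v\rangle}\,\varphi(\theta^{-1}\omega),\qquad g=(v,\theta),$$ and for a Borel probability measure $\mu$ on $G$ put $\pi_x(\mu)=\int_G\pi_x(g)\,d\mu(g)$, that is, $\pi_x(\mu)\varphi=\int_G\pi_x(g)\varphi\,d\mu(g)$. Let $\mu$ be a Borel probability measure on $G$ that is symmetric, i.e. invariant under $g\mapsto g^{-1}$. Assume that 1. there exists $\alpha>0$ such that $\|\pi_0(\mu)\varphi\|_2\le(1-\alpha)\|\varphi\|_2$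 for every $\varphi\in L^2_0(\mathrm{SO}(d))$; 2. for every $x\in\mathbb R^d$, $\mu(\{g\in G: gx\ne x\})>0$. Then there exists a constant $c_0>0$ (depending on $d$ and $\mu$) such that $$\|\pi_x(\mu)\|\le 1-c_0\min(|x|^2,1)\qquad\text{for every }x\in\mathbb R^d,$$ where $\|\cdot\|$ on the left is the operator norm on $L^2(\mathrm{SO}(d))$ and $|x|$ is the Euclidean norm. -/

import Mathlib

open MeasureTheory TopologicalSpace
open scoped ENNReal

noncomputable section

namespace EuclIsom

/-- The Euclidean space `ℝ^d`. -/
abbrev E (d : ℕ) : Type := EuclideanSpace ℝ (Fin d)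

/-- The rotation group `SO(d)`, with the topology induced from matrices. -/
abbrev SO (d : ℕ) : Type := Matrix.specialOrthogonalGroup (Fin d) ℝ

section Rotations

variable {d : ℕ}

theorem SO.mul_transpose (A : SO d) : A.1 * A.1.transpose = 1 :=
  (Matrix.mem_orthogonalGroup_iff (Fin d) ℝ).1 A.2.1

theorem SO.coe_inv (A : SO d) : (A⁻¹ : SO d).1 = A.1.transpose := rfl

instance : IsTopologicalGroup (SO d) where
  continuous_mul := by
    refine Continuous.subtype_mk ?_ _
    exact (continuous_subtype_val.comp continuous_fst).mul
      (continuous_subtype_val.comp continuous_snd)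
  continuous_inv := by
    refine Continuous.subtype_mk (f := fun A : SO d => A.1.transpose) ?_ _
    exact continuous_subtype_val.matrix_transpose

theorem SO.isClosed_coe :
    IsClosed ((Matrix.specialOrthogonalGroup (Fin d) ℝ : Submonoid (Matrix (Fin d) (Fin d) ℝ)) :
      Set (Matrix (Fin d) (Fin d) ℝ)) := by
  have h : ((Matrix.specialOrthogonalGroup (Fin d) ℝ : Submonoid (Matrix (Fin d) (Fin d) ℝ)) :
      Set (Matrix (Fin d) (Fin d) ℝ)) = {A | A * A.transpose = 1} ∩ {A | A.det = 1} := by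
    ext A
    simp only [SetLike.mem_coe, Matrix.mem_specialOrthogonalGroup_iff,
      Matrix.mem_orthogonalGroup_iff, Set.mem_inter_iff, Set.mem_ofPred_eq]
  rw [h]
  exact (isClosed_eq (continuous_id.mul continuous_id.matrix_transpose) continuous_const).inter
    (isClosed_eq continuous_id.matrix_det continuous_const)

theorem SO.abs_entry_le_one (A : SO d) (i j : Fin d) : |A.1 i j| ≤ 1 := by
  have h := congrFun (congrFun (SO.mul_transpose A) i) i
  rw [Matrix.mul_apply, Matrix.one_apply_eq] at h
  simp only [Matrix.transpose_apply] at h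
  have h2 : A.1 i j * A.1 i j ≤ 1 := by
    rw [← h]
    exact Finset.single_le_sum (f := fun k => A.1 i k * A.1 i k)
      (fun k _ => mul_self_nonneg _) (Finset.mem_univ j)
  rw [abs_le]
  constructor <;> nlinarith

instance : CompactSpace (SO d) := by
  refine isCompact_iff_compactSpace.1 ?_
  have hK : IsCompact (Set.pi Set.univ fun _ : Fin d =>
      Set.pi Set.univ fun _ : Fin d => Set.Icc (-1 : ℝ) 1) :=
    isCompact_univ_pi fun _ => isCompact_univ_pi fun _ => isCompact_Icc
  refine hK.of_isClosed_subset SO.isClosed_coe fun A hA i _ j _ => ?_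
  exact abs_le.1 (SO.abs_entry_le_one ⟨A, hA⟩ i j)

instance : MeasurableSpace (SO d) := borel _

instance : BorelSpace (SO d) := ⟨rfl⟩

instance : SecondCountableTopology (SO d) :=
  inferInstanceAs (SecondCountableTopology
    {A : Fin d → Fin d → ℝ // A ∈ Matrix.specialOrthogonalGroup (Fin d) ℝ})

instance : T2Space (SO d) :=
  inferInstanceAs (T2Space
    {A : Fin d → Fin d → ℝ // A ∈ Matrix.specialOrthogonalGroup (Fin d) ℝ})

/-- The rotation `A` applied to the vector `x`. -/
def rotate (A : SO d) (x : E d) : E d := WithLp.toLp 2 (A.1.mulVec x.ofLp)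

theorem rotate_one (x : E d) : rotate 1 x = x := by simp [rotate]

theorem rotate_mul (A B : SO d) (x : E d) : rotate (A * B) x = rotate A (rotate B x) := by
  simp [rotate]

theorem rotate_add (A : SO d) (x y : E d) : rotate A (x + y) = rotate A x + rotate A y := by
  simp [rotate, Matrix.mulVec_add]

theorem rotate_zero (A : SO d) : rotate A (0 : E d) = 0 := by
  simp [rotate]

theorem rotate_neg (A : SO d) (x : E d) : rotate A (-x) = -rotate A x := by
  simp [rotate, Matrix.mulVec_neg]

theorem inner_rotate (A : SO d) (x y : E d) :
    inner ℝ (rotate A x) y = inner ℝ x (rotate A⁻¹ y) := by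
  simp only [rotate, EuclideanSpace.inner_eq_star_dotProduct, SO.coe_inv, star_trivial]
  rw [Matrix.mulVec_transpose, ← Matrix.dotProduct_mulVec]

theorem continuous_rotate : Continuous fun p : SO d × E d => rotate p.1 p.2 := by
  refine (PiLp.continuous_toLp 2 _).comp ?_
  exact (continuous_subtype_val.comp continuous_fst).matrix_mulVec
    ((PiLp.continuous_ofLp 2 _).comp continuous_snd)

end Rotations

/-- The group `Isom(ℝ^d) = ℝ^d ⋊ SO(d)` of orientation-preserving isometries of `ℝ^d`:
the pair `(v, θ)` is the isometry `x ↦ v + θ x`. -/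
@[ext]
structure Isom (d : ℕ) where
  /-- the translation part -/
  v : E d
  /-- the rotation part -/
  θ : SO d

namespace Isom

variable {d : ℕ}

instance : Mul (Isom d) := ⟨fun g h => ⟨g.v + rotate g.θ h.v, g.θ * h.θ⟩⟩

instance : One (Isom d) := ⟨⟨0, 1⟩⟩

instance : Inv (Isom d) := ⟨fun g => ⟨-rotate g.θ⁻¹ g.v, g.θ⁻¹⟩⟩

@[simp] theorem mul_v (g h : Isom d) : (g * h).v = g.v + rotate g.θ h.v := rfl
@[simp] theorem mul_θ (g h : Isom d) : (g * h).θ = g.θ * h.θ := rfl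
@[simp] theorem one_v : (1 : Isom d).v = 0 := rfl
@[simp] theorem one_θ : (1 : Isom d).θ = 1 := rfl
@[simp] theorem inv_v (g : Isom d) : (g⁻¹).v = -rotate g.θ⁻¹ g.v := rfl
@[simp] theorem inv_θ (g : Isom d) : (g⁻¹).θ = g.θ⁻¹ := rfl

instance : Group (Isom d) :=
  Group.ofLeftAxioms
    (fun g h k => by
      ext1
      · simp [rotate_mul, rotate_add, add_assoc]
      · simp [mul_assoc])
    (fun g => by ext1 <;> simp [rotate_one])
    (fun g => by ext1 <;> simp)

/-- The action of isometries on `ℝ^d`. -/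
instance : MulAction (Isom d) (E d) where
  smul g x := g.v + rotate g.θ x
  one_smul x := by
    change (0 : E d) + rotate 1 x = x
    rw [rotate_one, zero_add]
  mul_smul g h x := by
    change (g.v + rotate g.θ h.v) + rotate (g.θ * h.θ) x = g.v + rotate g.θ (h.v + rotate h.θ x)
    rw [rotate_mul, rotate_add, add_assoc]

theorem smul_def (g : Isom d) (x : E d) : g • x = g.v + rotate g.θ x := rfl

/-- The topology of `ℝ^d × SO(d)`. -/
instance : TopologicalSpace (Isom d) := TopologicalSpace.induced (fun g => (g.v, g.θ)) inferInstance

theorem isInducing_pair : Topology.IsInducing fun g : Isom d => (g.v, g.θ) := ⟨rfl⟩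

theorem continuous_v : Continuous fun g : Isom d => g.v :=
  continuous_fst.comp isInducing_pair.continuous

theorem continuous_θ : Continuous fun g : Isom d => g.θ :=
  continuous_snd.comp isInducing_pair.continuous

instance : SecondCountableTopology (Isom d) := isInducing_pair.secondCountableTopology

instance : IsTopologicalGroup (Isom d) where
  continuous_mul := by
    refine isInducing_pair.continuous_iff.2 (Continuous.prodMk ?_ ?_)
    · exact (continuous_v.comp continuous_fst).add (continuous_rotate.comp
        ((continuous_θ.comp continuous_fst).prodMk (continuous_v.comp continuous_snd)))
    · exact (continuous_θ.comp continuous_fst).mul (continuous_θ.comp continuous_snd)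
  continuous_inv := by
    refine isInducing_pair.continuous_iff.2 (Continuous.prodMk ?_ ?_)
    · exact (continuous_rotate.comp (continuous_θ.inv.prodMk continuous_v)).neg
    · exact continuous_θ.inv

instance : MeasurableSpace (Isom d) := borel _

instance : BorelSpace (Isom d) := ⟨rfl⟩

end Isom

/-- The Haar probability measure of the compact group `SO(d)`. -/
def haarSO (d : ℕ) : Measure (SO d) := Measure.haarMeasure ⊤

instance (d : ℕ) : (haarSO d).IsHaarMeasure :=
  inferInstanceAs (Measure.haarMeasure (⊤ : PositiveCompacts (SO d))).IsHaarMeasure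

instance (d : ℕ) : IsProbabilityMeasure (haarSO d) :=
  ⟨by simpa [haarSO] using Measure.haarMeasure_self (K₀ := (⊤ : PositiveCompacts (SO d)))⟩

/-- The Hilbert space `L²(SO(d))` of complex-valued functions. -/
abbrev L2 (d : ℕ) : Type := Lp ℂ 2 (haarSO d)

/-- The subspace `L²₀(SO(d))` of functions of mean zero. -/
def L20 (d : ℕ) : Submodule ℂ (L2 d) where
  carrier := {φ | ∫ ω, φ ω ∂haarSO d = 0}
  zero_mem' := by
    change ∫ ω, (0 : L2 d) ω ∂haarSO d = 0
    rw [integral_congr_ae (Lp.coeFn_zero ℂ 2 (haarSO d))]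
    simp
  add_mem' := by
    intro φ ψ hφ hψ
    change ∫ ω, φ ω ∂haarSO d = 0 at hφ
    change ∫ ω, ψ ω ∂haarSO d = 0 at hψ
    change ∫ ω, (φ + ψ) ω ∂haarSO d = 0
    rw [integral_congr_ae (Lp.coeFn_add φ ψ)]
    simp only [Pi.add_apply]
    rw [integral_add ((Lp.memLp φ).integrable (by norm_num))
      ((Lp.memLp ψ).integrable (by norm_num)), hφ, hψ, add_zero]
  smul_mem' := by
    intro c φ hφ
    change ∫ ω, φ ω ∂haarSO d = 0 at hφ
    change ∫ ω, (c • φ) ω ∂haarSO d = 0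
    rw [integral_congr_ae (Lp.coeFn_smul c φ)]
    simp only [Pi.smul_apply]
    rw [integral_smul, hφ, smul_zero]

/-- The character `e(y) = exp(-2πiy)`. -/
def e (y : ℝ) : ℂ := Complex.exp (-(2 * Real.pi * y : ℝ) * Complex.I)

theorem norm_e (y : ℝ) : ‖e y‖ = 1 := by
  rw [e, ← Complex.ofReal_neg, Complex.norm_exp_ofReal_mul_I]

theorem e_add (y z : ℝ) : e (y + z) = e y * e z := by
  rw [e, e, e, ← Complex.exp_add]
  congr 1
  push_cast
  ring

theorem e_zero : e 0 = 1 := by simp [e]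

theorem continuous_e : Continuous e := by
  unfold e
  fun_prop

section Representation

variable {d : ℕ}

/-- The continuous function `ω ↦ e(⟨ω x, v⟩)` on `SO(d)`. -/
def phase (x v : E d) : C(SO d, ℂ) where
  toFun ω := e (inner ℝ (rotate ω x) v)
  continuous_toFun := continuous_e.comp
    ((continuous_rotate.comp (continuous_id.prodMk continuous_const)).inner continuous_const)

theorem continuous_phase (x : E d) : Continuous fun v : E d => phase x v := by
  refine ContinuousMap.continuous_of_continuous_uncurry _ ?_
  exact continuous_e.comp
    ((continuous_rotate.comp (continuous_snd.prodMk continuous_const)).inner continuous_fst)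

/-- The continuous map `ω ↦ θ⁻¹ ω` of `SO(d)`. -/
def leftMul (θ : SO d) : C(SO d, SO d) where
  toFun ω := θ⁻¹ * ω
  continuous_toFun := continuous_const.mul continuous_id

theorem measurePreserving_leftMul (θ : SO d) :
    MeasurePreserving (leftMul θ) (haarSO d) (haarSO d) :=
  measurePreserving_mul_left (haarSO d) θ⁻¹

theorem continuous_leftMul : Continuous fun θ : SO d => leftMul θ := by
  refine ContinuousMap.continuous_of_continuous_uncurry _ ?_
  exact continuous_fst.inv.mul continuous_snd

/-- The function `π_x(g)φ`, for `g = (v, θ)`: it is `ω ↦ e(⟨ω x, v⟩) φ(θ⁻¹ ω)`, see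
`piFun_ae`. -/
def piFun (x : E d) (g : Isom d) (φ : L2 d) : L2 d :=
  (ContinuousLinearMap.mul ℂ ℂ).holderL (haarSO d) ∞ 2 2
    (ContinuousMap.toLp ∞ (haarSO d) ℂ (phase x g.v))
    (Lp.compMeasurePreserving (leftMul g.θ) (measurePreserving_leftMul g.θ) φ)

theorem piFun_ae (x : E d) (g : Isom d) (φ : L2 d) :
    ∀ᵐ ω ∂haarSO d, piFun x g φ ω = e (inner ℝ (rotate ω x) g.v) * φ (g.θ⁻¹ * ω) := by
  have h1 := (ContinuousLinearMap.mul ℂ ℂ).coeFn_holder (r := 2)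
    (ContinuousMap.toLp ∞ (haarSO d) ℂ (phase x g.v))
    (Lp.compMeasurePreserving (leftMul g.θ) (measurePreserving_leftMul g.θ) φ)
  have h2 := ContinuousMap.coeFn_toLp (p := ∞) (𝕜 := ℂ) (haarSO d) (phase x g.v)
  have h3 := Lp.coeFn_compMeasurePreserving φ (measurePreserving_leftMul g.θ)
  filter_upwards [h1, h2, h3] with ω h1 h2 h3
  refine h1.trans ?_
  rw [h2, h3]
  rfl

/-- Strong continuity. -/
theorem continuous_piFun (x : E d) (φ : L2 d) : Continuous fun g : Isom d => piFun x g φ := by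
  have hA : Continuous fun g : Isom d =>
      (ContinuousLinearMap.mul ℂ ℂ).holderL (haarSO d) ∞ 2 2
        (ContinuousMap.toLp ∞ (haarSO d) ℂ (phase x g.v)) :=
    (ContinuousLinearMap.continuous _).comp ((ContinuousLinearMap.continuous _).comp
      ((continuous_phase x).comp Isom.continuous_v))
  have hB : Continuous fun g : Isom d =>
      Lp.compMeasurePreserving (leftMul g.θ) (measurePreserving_leftMul g.θ) φ :=
    Continuous.compMeasurePreservingLp continuous_const
      (continuous_leftMul.comp Isom.continuous_θ) _ (by norm_num)
  exact hA.clm_apply hB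

theorem piFun_one (x : E d) (φ : L2 d) : piFun x 1 φ = φ := by
  refine Lp.ext ?_
  filter_upwards [piFun_ae x 1 φ] with ω h
  simpa [e_zero] using h

theorem piFun_mul (x : E d) (g h : Isom d) (φ : L2 d) :
    piFun x (g * h) φ = piFun x g (piFun x h φ) := by
  refine Lp.ext ?_
  filter_upwards [piFun_ae x (g * h) φ, piFun_ae x g (piFun x h φ),
    (measurePreserving_leftMul g.θ).quasiMeasurePreserving.ae (piFun_ae x h φ)] with ω h1 h2 h3
  rw [h1, h2]
  change piFun x h φ (g.θ⁻¹ * ω) = e (inner ℝ (rotate (g.θ⁻¹ * ω) x) h.v) *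
    φ (h.θ⁻¹ * (g.θ⁻¹ * ω)) at h3
  have h4 : inner ℝ (rotate (g.θ⁻¹ * ω) x) h.v = inner ℝ (rotate ω x) (rotate g.θ h.v) := by
    rw [rotate_mul, inner_rotate, inv_inv]
  rw [h3, h4, Isom.mul_v, inner_add_right, e_add, Isom.mul_θ, mul_inv_rev, mul_assoc, mul_assoc]

theorem piFun_add (x : E d) (g : Isom d) (φ ψ : L2 d) :
    piFun x g (φ + ψ) = piFun x g φ + piFun x g ψ := by
  simp only [piFun, map_add]

theorem piFun_smul (x : E d) (g : Isom d) (c : ℂ) (φ : L2 d) :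
    piFun x g (c • φ) = c • piFun x g φ := by
  have h : Lp.compMeasurePreserving (leftMul g.θ) (measurePreserving_leftMul g.θ) (c • φ) =
      c • Lp.compMeasurePreserving (leftMul g.θ) (measurePreserving_leftMul g.θ) φ :=
    (Lp.compMeasurePreservingₗ ℂ (leftMul g.θ) (measurePreserving_leftMul g.θ)).map_smul c φ
  simp only [piFun, h, map_smul]

theorem norm_piFun (x : E d) (g : Isom d) (φ : L2 d) : ‖piFun x g φ‖ = ‖φ‖ := by
  rw [← Lp.norm_compMeasurePreserving φ (measurePreserving_leftMul g.θ), Lp.norm_def, Lp.norm_def]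
  congr 1
  refine eLpNorm_congr_norm_ae ?_
  filter_upwards [piFun_ae x g φ, Lp.coeFn_compMeasurePreserving φ (measurePreserving_leftMul g.θ)]
    with ω h1 h2
  rw [h1, h2, norm_mul, norm_e, one_mul]
  rfl

/-- The unitary representation `π_x` of `Isom(ℝ^d)` on `L²(SO(d))`:
`(π_x(g)φ)(ω) = e(⟨ω x, v⟩) φ(θ⁻¹ ω)` for `g = (v, θ)`. -/
def piRep (x : E d) : Isom d →* (L2 d ≃ₗᵢ[ℂ] L2 d) where
  toFun g :=
    { toFun := piFun x g
      invFun := piFun x g⁻¹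
      map_add' := piFun_add x g
      map_smul' := piFun_smul x g
      left_inv := fun φ => by rw [← piFun_mul, inv_mul_cancel, piFun_one]
      right_inv := fun φ => by rw [← piFun_mul, mul_inv_cancel, piFun_one]
      norm_map' := norm_piFun x g }
  map_one' := by
    ext1 φ
    exact piFun_one x φ
  map_mul' g h := by
    ext1 φ
    exact piFun_mul x g h φ

theorem integrable_piRep (x : E d) (μ : Measure (Isom d)) [IsProbabilityMeasure μ] (φ : L2 d) :
    Integrable (fun g => piRep x g φ) μ :=
  Integrable.of_bound (continuous_piFun x φ).aestronglyMeasurable ‖φ‖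
    (Filter.Eventually.of_forall fun g => (norm_piFun x g φ).le)

/-- The averaging operator `π_x(μ) = ∫ π_x(g) dμ(g)` on `L²(SO(d))`; the integral is taken in the
strong sense, `π_x(μ)φ = ∫ π_x(g)φ dμ(g)`. -/
def piMeasure (x : E d) (μ : Measure (Isom d)) [IsProbabilityMeasure μ] : L2 d →L[ℂ] L2 d :=
  LinearMap.mkContinuous
    { toFun := fun φ => ∫ g, piRep x g φ ∂μ
      map_add' := fun φ ψ => by
        simp only [map_add]
        exact integral_add (integrable_piRep x μ φ) (integrable_piRep x μ ψ)
      map_smul' := fun c φ => by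
        simp only [map_smul, RingHom.id_apply]
        exact integral_smul c _ }
    1 fun φ => by
      refine (norm_integral_le_of_norm_le_const (C := ‖φ‖)
        (Filter.Eventually.of_forall fun g => (norm_piFun x g φ).le)).trans ?_
      simp

end Representation

end EuclIsom

end

/-!
Let `ν` be the law of `h⁻¹ g`, for `g` and `h` independent with law `μ`. Since `π_x` is unitary,
`‖φ‖² - ‖π_x(μ)φ‖²` is half the energy `∫ ‖π_x(g)φ - φ‖² dν(g)`, so that the theorem asks for a lower
bound `c min(|x|², 1) ‖φ‖²` on the energy (`exists_le_energy`). The spectral gap says that the energy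
at `x = 0` controls the distance to the constants, and, by the symmetry of `μ`, no point of `ℝ^d` is
fixed by `ν`-almost every isometry (`not_ae_quotientLaw_smul_eq`).

For small `x` (`exists_le_energy_of_norm_le`), a function `φ` of small energy is close to its mean,
by the spectral gap. Expanding `e(⟨ω x, v⟩)` to first order, and pairing the imaginary part of `φ`
with the linear functions on the sphere, one finds a vector `u`, a multiple of `firstMoment`
by a factor of order `1 / |x|`, such that the mean square of a weighted `g u - u` is at most the
energy divided by `|x|²`, up to a constant factor and a small error. As there is no common fixed
point, this mean square is bounded below uniformly in `u` (`exists_le_integral_displacement`), and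
the energy is at least of order `|x|²`.

Large `x` reduce to small ones. The absolute value of a function of small energy has small
energy at `0`, hence is almost constant, and `φ` may be replaced by the unimodular `φ / |φ|`. For
unimodular `φ` and a rotation `k`, the function `ω ↦ φ(ω) conj φ(ωk)` is again unimodular, and its
energy at the frequency `x - kx` is at most four times that of `φ` at `x`
(`exists_energy_sub_rotate_le`). Choosing `k` with `|x - kx| = r₀` for a small fixed `r₀` gives
a lower bound that does not depend on `x` (`le_energy_of_unimodular`).
-/

noncomputable section

namespace EuclIsom

variable {d : ℕ}

/-! ### The rotation group: isometries, transitivity on spheres, second moments -/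

theorem inner_rotate_rotate (A : SO d) (x y : E d) :
    inner ℝ (rotate A x) (rotate A y) = inner ℝ x y := by
  rw [inner_rotate, ← rotate_mul, inv_mul_cancel, rotate_one]

theorem norm_rotate (A : SO d) (x : E d) : ‖rotate A x‖ = ‖x‖ := by
  rw [norm_eq_sqrt_real_inner, norm_eq_sqrt_real_inner, inner_rotate_rotate]

theorem rotate_smul (A : SO d) (c : ℝ) (x : E d) : rotate A (c • x) = c • rotate A x := by
  simp [rotate, Matrix.mulVec_smul]

theorem rotate_sub (A : SO d) (x y : E d) : rotate A (x - y) = rotate A x - rotate A y := by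
  rw [sub_eq_add_neg, rotate_add, rotate_neg, ← sub_eq_add_neg]

/-- A rotation as a linear isometry of `ℝ^d`. -/
def rotateIsometry (A : SO d) : E d →ₗᵢ[ℝ] E d where
  toFun := rotate A
  map_add' := rotate_add A
  map_smul' := rotate_smul A
  norm_map' := norm_rotate A

theorem continuous_rotate_left (x : E d) : Continuous fun A : SO d => rotate A x :=
  continuous_rotate.comp (continuous_id.prodMk continuous_const)

/-- The matrix of the reflection in the hyperplane orthogonal to `a`, when `a` is a unit vector. -/
def reflectionMatrix (a : E d) : Matrix (Fin d) (Fin d) ℝ :=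
  1 - (2 : ℝ) • Matrix.vecMulVec a.ofLp a.ofLp

theorem reflectionMatrix_mulVec (a x : E d) :
    (reflectionMatrix a).mulVec x.ofLp = (x - (2 * inner ℝ a x) • a).ofLp := by
  ext i
  simp only [reflectionMatrix, Matrix.sub_mulVec, Matrix.one_mulVec, Matrix.smul_mulVec,
    Matrix.vecMulVec_mulVec, EuclideanSpace.inner_eq_star_dotProduct, star_trivial]
  simp [dotProduct_comm]
  ring

theorem dotProduct_self_eq_one {a : E d} (ha : ‖a‖ = 1) : a.ofLp ⬝ᵥ a.ofLp = 1 := by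
  have := real_inner_self_eq_norm_sq a
  rw [ha, EuclideanSpace.inner_eq_star_dotProduct, star_trivial] at this
  simpa using this

theorem reflectionMatrix_mul_transpose {a : E d} (ha : ‖a‖ = 1) :
    reflectionMatrix a * (reflectionMatrix a).transpose = 1 := by
  have h1 := dotProduct_self_eq_one ha
  have hT : (reflectionMatrix a).transpose = reflectionMatrix a := by
    simp [reflectionMatrix, Matrix.transpose_sub, Matrix.transpose_smul, Matrix.transpose_vecMulVec]
  have h2 : Matrix.vecMulVec a.ofLp a.ofLp * Matrix.vecMulVec a.ofLp a.ofLp =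
      Matrix.vecMulVec a.ofLp a.ofLp := by
    rw [Matrix.vecMulVec_mul_vecMulVec, h1, one_smul]
  rw [hT, reflectionMatrix, sub_mul, mul_sub, mul_sub, smul_mul_smul_comm, h2]
  simp only [one_mul, mul_one]
  module

theorem det_reflectionMatrix {a : E d} (ha : ‖a‖ = 1) : (reflectionMatrix a).det = -1 := by
  have h1 := dotProduct_self_eq_one ha
  have h2 : reflectionMatrix a = 1 + Matrix.replicateCol Unit ((-2 : ℝ) • a.ofLp) *
      Matrix.replicateRow Unit a.ofLp := by
    rw [reflectionMatrix, sub_eq_add_neg, ← neg_smul, ← Matrix.smul_vecMulVec,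
      Matrix.vecMulVec_eq Unit]
  rw [h2, Matrix.det_one_add_replicateCol_mul_replicateRow, dotProduct_smul, h1]
  norm_num

theorem exists_unit_inner_eq_zero (hd : 2 ≤ d) (x : E d) : ∃ b : E d, ‖b‖ = 1 ∧ inner ℝ b x = 0 := by
  have h1 : Module.finrank ℝ (ℝ ∙ x) ≤ 1 := (finrank_span_le_card {x}).trans (by simp)
  have h2 := (ℝ ∙ x).finrank_add_finrank_orthogonal
  rw [finrank_euclideanSpace_fin] at h2
  have h3 : (ℝ ∙ x)ᗮ ≠ ⊥ := fun h => by
    rw [h, finrank_bot] at h2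
    omega
  obtain ⟨b, hb, hb0⟩ := Submodule.exists_mem_ne_zero_of_ne_bot h3
  refine ⟨‖b‖⁻¹ • b, norm_smul_inv_norm hb0, ?_⟩
  rw [inner_smul_left, real_inner_comm,
    (Submodule.mem_orthogonal _ _).1 hb x (Submodule.mem_span_singleton_self x), mul_zero]

/-- `SO(d)` acts transitively on spheres: the rotation is a product of two reflections, one of which
fixes `x`. -/
theorem exists_rotate_eq (hd : 2 ≤ d) {x y : E d} (h : ‖x‖ = ‖y‖) : ∃ k : SO d, rotate k x = y := by
  by_cases hxy : x = y
  · exact ⟨1, by rw [rotate_one, hxy]⟩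
  obtain ⟨b, hb, hbx⟩ := exists_unit_inner_eq_zero hd x
  have h0 : ‖x - y‖ ≠ 0 := by rwa [norm_ne_zero_iff, sub_ne_zero]
  set a : E d := ‖x - y‖⁻¹ • (x - y) with ha_def
  have ha : ‖a‖ = 1 := norm_smul_inv_norm (norm_ne_zero_iff.1 h0)
  have hmem : reflectionMatrix a * reflectionMatrix b ∈ Matrix.specialOrthogonalGroup (Fin d) ℝ := by
    rw [Matrix.mem_specialOrthogonalGroup_iff, Matrix.mem_orthogonalGroup_iff, Matrix.det_mul,
      det_reflectionMatrix ha, det_reflectionMatrix hb, Matrix.transpose_mul]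
    refine ⟨?_, by norm_num⟩
    rw [mul_assoc, ← mul_assoc (reflectionMatrix b), reflectionMatrix_mul_transpose hb, one_mul,
      reflectionMatrix_mul_transpose ha]
  refine ⟨⟨_, hmem⟩, ?_⟩
  have h1 : (2 * inner ℝ a x) • a = x - y := by
    have h2 : 2 * inner ℝ (x - y) x = ‖x - y‖ ^ 2 := by
      rw [norm_sub_sq_real, inner_sub_left, real_inner_self_eq_norm_sq, ← h, real_inner_comm]
      ring
    rw [ha_def, inner_smul_left, smul_smul]
    have h3 : 2 * ((starRingEnd ℝ) ‖x - y‖⁻¹ * inner ℝ (x - y) x) * ‖x - y‖⁻¹ = 1 := by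
      rw [conj_trivial]
      field_simp
      linarith
    rw [h3, one_smul]
  change WithLp.toLp 2 ((reflectionMatrix a * reflectionMatrix b).mulVec x.ofLp) = y
  rw [← Matrix.mulVec_mulVec, reflectionMatrix_mulVec b, hbx, mul_zero, zero_smul, sub_zero,
    reflectionMatrix_mulVec, h1, sub_sub_cancel]

/-- Rotations displace `x` by every distance up to the radius `‖x‖`. -/
theorem exists_norm_sub_rotate_eq (hd : 2 ≤ d) {x : E d} {r : ℝ} (hr : 0 < r) (hrx : r ≤ ‖x‖) :
    ∃ k : SO d, ‖x - rotate k x‖ = r := by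
  obtain ⟨b, hb, hbx⟩ := exists_unit_inner_eq_zero hd x
  have hx : 0 < ‖x‖ := hr.trans_le hrx
  -- the unit vector `a` makes `x - 2⟪a, x⟫a` lie at distance `2⟪a, x⟫ = r` from `x`
  set s : ℝ := r / (2 * ‖x‖) with hs
  have hs1 : s ^ 2 ≤ 1 := by
    rw [sq_le_one_iff₀ (by positivity), hs, div_le_one (by positivity)]
    linarith
  set a : E d := (s * ‖x‖⁻¹) • x + √(1 - s ^ 2) • b with ha_def
  have hxb : inner ℝ x b = 0 := by rw [real_inner_comm, hbx]
  have ha : ‖a‖ ^ 2 = 1 := by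
    rw [← real_inner_self_eq_norm_sq, ha_def]
    simp only [inner_add_left, inner_add_right, inner_smul_left, inner_smul_right, hbx, hxb,
      real_inner_self_eq_norm_sq, hb, conj_trivial]
    have := Real.sq_sqrt (sub_nonneg.2 hs1)
    field_simp
    nlinarith
  have hax : 2 * inner ℝ a x = r := by
    rw [ha_def]
    simp only [inner_add_left, inner_smul_left, hbx, real_inner_self_eq_norm_sq, conj_trivial, hs]
    field_simp
    ring
  have hy : ‖x‖ = ‖x - r • a‖ := by
    rw [← sq_eq_sq₀ (norm_nonneg _) (norm_nonneg _), norm_sub_sq_real, norm_smul, mul_pow, ha,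
      inner_smul_right, real_inner_comm, Real.norm_eq_abs, sq_abs]
    linear_combination r * hax
  obtain ⟨k, hk⟩ := exists_rotate_eq hd hy
  refine ⟨k, ?_⟩
  have : ‖a‖ = 1 := (pow_eq_one_iff_of_nonneg (norm_nonneg a) two_ne_zero).1 ha
  rw [hk, sub_sub_cancel, norm_smul, this, mul_one, Real.norm_of_nonneg hr.le]

/-- The compact group `SO(d)` is unimodular. -/
instance : (haarSO d).IsMulRightInvariant where
  map_mul_right_eq_self g := by
    have : IsProbabilityMeasure ((haarSO d).map (· * g)) :=
      Measure.isProbabilityMeasure_map (measurable_mul_const g).aemeasurable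
    have : ((haarSO d).map (· * g)).IsHaarMeasure :=
      ⟨⟩
    exact Measure.isHaarMeasure_eq_of_isProbabilityMeasure _ _

/-- A continuous function on the compact group `SO(d)` is integrable. -/
theorem integrable_of_continuous {F : Type*} [NormedAddCommGroup F] {f : SO d → F}
    (hf : Continuous f) : Integrable f (haarSO d) :=
  hf.integrable_of_hasCompactSupport (HasCompactSupport.of_compactSpace f)

theorem integral_inner_rotate_sq (hd : 2 ≤ d) {x p : E d} (hx : ‖x‖ = 1) :
    ∫ ω, inner ℝ (rotate ω x) p ^ 2 ∂haarSO d = ‖p‖ ^ 2 / d := by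
  set q : E d → ℝ := fun p => ∫ ω, inner ℝ (rotate ω x) p ^ 2 ∂haarSO d with hq
  have hinv (k : SO d) (p : E d) : q (rotate k p) = q p := by
    simp only [hq]
    rw [← integral_mul_left_eq_self _ k]
    simp only [rotate_mul, inner_rotate_rotate]
  have hsmul (c : ℝ) (p : E d) : q (c • p) = c ^ 2 * q p := by
    simp only [hq, inner_smul_right, mul_pow]
    exact integral_const_mul _ _
  have heq (p p' : E d) (h : ‖p‖ = ‖p'‖) : q p = q p' := by
    obtain ⟨k, rfl⟩ := exists_rotate_eq hd h
    exact (hinv k p).symm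
  have hd0 : 0 < d := by omega
  set i₀ : Fin d := ⟨0, hd0⟩
  set b := EuclideanSpace.basisFun (Fin d) ℝ with hb
  have hsum : ∑ i, q (b i) = 1 := by
    simp only [hq]
    rw [← integral_finsetSum _ fun i _ => integrable_of_continuous
      (((continuous_rotate_left x).inner continuous_const).pow 2)]
    have : ∀ ω : SO d, ∑ i, inner ℝ (rotate ω x) (b i) ^ 2 = 1 := fun ω => by
      have := b.sum_sq_norm_inner_left (rotate ω x)
      simp only [Real.norm_eq_abs, sq_abs] at this
      rw [this, norm_rotate, hx, one_pow]
    simp [this]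
  have hconst (i : Fin d) : q (b i) = q (b i₀) := heq _ _ (by simp [hb])
  simp only [hconst, Finset.sum_const, Finset.card_univ, Fintype.card_fin, nsmul_eq_mul] at hsum
  have h1 : q p = ‖p‖ ^ 2 * q (b i₀) := by
    rw [← hsmul]
    refine heq _ _ ?_
    simp [norm_smul, hb]
  change q p = _
  rw [h1, eq_div_iff (by positivity)]
  linear_combination ‖p‖ ^ 2 * hsum

/-- The second moment of the uniform distribution on the unit sphere is `1/d` times the identity:
it is isotropic with trace one. -/
theorem integral_inner_rotate_smul (hd : 2 ≤ d) {x : E d} (hx : ‖x‖ = 1) (p : E d) :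
    ∫ ω, inner ℝ (rotate ω x) p • rotate ω x ∂haarSO d = (d : ℝ)⁻¹ • p := by
  refine ext_inner_right ℝ fun r => ?_
  have hc (p : E d) : Continuous fun ω : SO d => inner ℝ (rotate ω x) p :=
    (continuous_rotate_left x).inner continuous_const
  have hint : Integrable (fun ω : SO d => inner ℝ (rotate ω x) p • rotate ω x) (haarSO d) :=
    integrable_of_continuous ((hc p).smul (continuous_rotate_left x))
  rw [real_inner_comm, ← integral_inner hint]
  have h1 (ω : SO d) : inner ℝ r (inner ℝ (rotate ω x) p • rotate ω x) =
      (inner ℝ (rotate ω x) (p + r) ^ 2 - inner ℝ (rotate ω x) (p - r) ^ 2) / 4 := by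
    rw [inner_smul_right, inner_add_right, inner_sub_right, real_inner_comm r]
    ring
  simp only [h1]
  have hsq (p : E d) : Integrable (fun ω : SO d => inner ℝ (rotate ω x) p ^ 2) (haarSO d) :=
    integrable_of_continuous ((hc p).pow 2)
  rw [integral_div, integral_sub (hsq _) (hsq _), integral_inner_rotate_sq hd hx,
    integral_inner_rotate_sq hd hx, norm_add_sq_real, norm_sub_sq_real, inner_smul_left,
    conj_trivial]
  ring

/-! ### Displacement of points by a random isometry -/

theorem norm_toLp_sq {X F : Type*} [MeasurableSpace X] [NormedAddCommGroup F] {m : Measure X}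
    {f : X → F} (hf : MemLp f 2 m) : ‖hf.toLp f‖ ^ 2 = ∫ a, ‖f a‖ ^ 2 ∂m := by
  have h0 : 0 ≤ ∫ a, ‖f a‖ ^ 2 ∂m := integral_nonneg fun _ => by positivity
  rw [Lp.norm_toLp, hf.eLpNorm_eq_integral_rpow_norm two_ne_zero ENNReal.ofNat_ne_top]
  simp only [ENNReal.toReal_ofNat, Real.rpow_ofNat]
  rw [ENNReal.toReal_ofReal (by positivity), ← Real.rpow_natCast, ← Real.rpow_mul h0]
  norm_num

theorem norm_sq_eq_integral {X F : Type*} [MeasurableSpace X] [NormedAddCommGroup F] {m : Measure X}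
    (f : Lp F 2 m) : ‖f‖ ^ 2 = ∫ a, ‖f a‖ ^ 2 ∂m := by
  conv_lhs => rw [← Lp.toLp_coeFn f (Lp.memLp f)]
  exact norm_toLp_sq (Lp.memLp f)

/-- A random isometry without a common fixed point displaces all points by a uniformly positive
amount. The weight `1 / (1 + |v|²)` makes up for missing moments of the translation part `v`. With
it, the right-hand side is the squared `L²(ν)`-distance of the vector `-v` from an element of
the finite-dimensional, hence closed, subspace of all functions `g ↦ θ u - u`. -/
theorem exists_le_integral_displacement (ν : Measure (Isom d)) [IsProbabilityMeasure ν]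
    (hν : ∀ u : E d, ¬ ∀ᵐ g ∂ν, g • u = u) :
    ∃ δ : ℝ, 0 < δ ∧ ∀ u : E d, δ ≤ ∫ g : Isom d, (‖g • u - u‖ / (1 + ‖g.v‖ ^ 2)) ^ 2 ∂ν := by
  set s : Isom d → ℝ := fun g => (1 + ‖g.v‖ ^ 2)⁻¹ with hs
  have hs0 (g : Isom d) : 0 < s g := by positivity
  have hs1 (g : Isom d) : s g ≤ 1 := inv_le_one_of_one_le₀ (by nlinarith [sq_nonneg ‖g.v‖])
  have hsc : Continuous s :=
    (continuous_const.add (Isom.continuous_v.norm.pow 2)).inv₀ fun g => by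
      simp only [Pi.add_apply, Pi.pow_apply]; positivity
  have hrc (u : E d) : Continuous fun g : Isom d => rotate g.θ u :=
    (continuous_rotate_left u).comp Isom.continuous_θ
  have hL (u : E d) : MemLp (fun g => s g • (rotate g.θ u - u)) 2 ν := by
    refine MemLp.of_bound
      (hsc.smul ((hrc u).sub continuous_const)).aestronglyMeasurable (2 * ‖u‖)
      (Filter.Eventually.of_forall fun g => ?_)
    rw [norm_smul, Real.norm_of_nonneg (hs0 g).le]
    have := norm_sub_le (rotate g.θ u) u
    rw [norm_rotate] at this
    nlinarith [hs0 g, hs1 g, norm_nonneg (rotate g.θ u - u)]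
  have hB : MemLp (fun g => s g • g.v) 2 ν := by
    refine MemLp.of_bound (hsc.smul Isom.continuous_v).aestronglyMeasurable 1
      (Filter.Eventually.of_forall fun g => ?_)
    rw [norm_smul, Real.norm_of_nonneg (hs0 g).le, inv_mul_le_one₀ (by positivity)]
    nlinarith [sq_nonneg (‖g.v‖ - 1)]
  let L : E d →ₗ[ℝ] Lp (E d) 2 ν :=
    { toFun := fun u => (hL u).toLp _
      map_add' := fun u u' => by
        rw [← MemLp.toLp_add]
        refine MemLp.toLp_congr _ _ (Filter.Eventually.of_forall fun g => ?_)
        simp only [Pi.add_apply, rotate_add]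
        module
      map_smul' := fun c u => by
        rw [RingHom.id_apply, ← MemLp.toLp_const_smul]
        refine MemLp.toLp_congr _ _ (Filter.Eventually.of_forall fun g => ?_)
        simp only [Pi.smul_apply, rotate_smul]
        module }
  have hsum (u : E d) : L u + hB.toLp _ =
      ((hL u).add hB).toLp (fun g => s g • (rotate g.θ u - u) + s g • g.v) :=
    (MemLp.toLp_add (hL u) hB).symm
  have hpt (u : E d) (g : Isom d) :
      s g • (rotate g.θ u - u) + s g • g.v = s g • (g • u - u) := by
    rw [Isom.smul_def]
    module
  have hnorm (u : E d) : ∫ g : Isom d, (‖g • u - u‖ / (1 + ‖g.v‖ ^ 2)) ^ 2 ∂ν =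
      ‖L u + hB.toLp _‖ ^ 2 := by
    rw [hsum, norm_toLp_sq]
    refine integral_congr_ae (Filter.Eventually.of_forall fun g => ?_)
    simp only [hpt]
    rw [norm_smul, Real.norm_of_nonneg (hs0 g).le, div_eq_inv_mul]
  have hclosed : IsClosed (LinearMap.range L : Set (Lp (E d) 2 ν)) :=
    Submodule.closed_of_finiteDimensional _
  have hnot : -hB.toLp _ ∉ (LinearMap.range L : Set (Lp (E d) 2 ν)) := by
    rintro ⟨u, hu⟩
    refine hν u ?_
    have h0 : L u + hB.toLp _ = 0 := by rw [hu, neg_add_cancel]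
    rw [hsum] at h0
    filter_upwards [MemLp.coeFn_toLp ((hL u).add hB), Lp.eq_zero_iff_ae_eq_zero.1 h0] with g h1 h2
    have h3 : s g • (rotate g.θ u - u) + s g • g.v = 0 := h1.symm.trans h2
    rw [hpt, smul_eq_zero] at h3
    exact sub_eq_zero.1 (h3.resolve_left (hs0 g).ne')
  obtain ⟨r, hr, hball⟩ := Metric.isOpen_iff.1 hclosed.isOpen_compl _ hnot
  refine ⟨r ^ 2, by positivity, fun u => ?_⟩
  rw [hnorm]
  refine pow_le_pow_left₀ hr.le ?_ 2
  by_contra! hlt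
  have hmem : L u ∈ Metric.ball (-hB.toLp _) r := by
    rwa [Metric.mem_ball, dist_eq_norm, sub_neg_eq_add]
  exact hball hmem ⟨u, rfl⟩

/-! ### The energy of a function under a random isometry -/

/-- The mean squared displacement of `φ` under `π_x(g)`, for `g` distributed according to `ν`. -/
def energy (ν : Measure (Isom d)) (x : E d) (φ : L2 d) : ℝ := ∫ g, ‖piFun x g φ - φ‖ ^ 2 ∂ν

theorem energy_nonneg (ν : Measure (Isom d)) (x : E d) (φ : L2 d) : 0 ≤ energy ν x φ :=
  integral_nonneg fun _ => by positivity

theorem piFun_sub (x : E d) (g : Isom d) (φ ψ : L2 d) :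
    piFun x g (φ - ψ) = piFun x g φ - piFun x g ψ :=
  map_sub (piRep x g) φ ψ

theorem integrable_energy (ν : Measure (Isom d)) [IsProbabilityMeasure ν] (x : E d) (φ : L2 d) :
    Integrable (fun g => ‖piFun x g φ - φ‖ ^ 2) ν := by
  refine Integrable.of_bound
    (((continuous_piFun x φ).sub continuous_const).norm.pow 2).aestronglyMeasurable
    ((2 * ‖φ‖) ^ 2) (Filter.Eventually.of_forall fun g => ?_)
  rw [Real.norm_of_nonneg (by positivity)]
  refine pow_le_pow_left₀ (norm_nonneg _) ?_ 2
  have := norm_sub_le (piFun x g φ) φ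
  rw [norm_piFun] at this
  linarith

theorem energy_smul (ν : Measure (Isom d)) (x : E d) (c : ℂ) (φ : L2 d) :
    energy ν x (c • φ) = ‖c‖ ^ 2 * energy ν x φ := by
  simp only [energy, piFun_smul, ← smul_sub, norm_smul, mul_pow]
  exact integral_const_mul _ _

/-- The law of `h⁻¹ g` for independent `g` and `h` with law `μ`. -/
def quotientLaw (μ : Measure (Isom d)) : Measure (Isom d) :=
  (μ.prod μ).map fun p => p.2⁻¹ * p.1

theorem continuous_quotient : Continuous fun p : Isom d × Isom d => p.2⁻¹ * p.1 :=
  continuous_snd.inv.mul continuous_fst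

instance (μ : Measure (Isom d)) [IsProbabilityMeasure μ] : IsProbabilityMeasure (quotientLaw μ) :=
  Measure.isProbabilityMeasure_map continuous_quotient.measurable.aemeasurable

/-- The defect `‖φ‖² - ‖π_x(μ)φ‖²` is half the energy for the law of the quotient of two
independent copies. -/
theorem energy_quotientLaw (μ : Measure (Isom d)) [IsProbabilityMeasure μ] (x : E d) (φ : L2 d) :
    energy (quotientLaw μ) x φ = 2 * ‖φ‖ ^ 2 - 2 * ‖piMeasure x μ φ‖ ^ 2 := by
  have hc := continuous_piFun x φ
  have hint : Integrable (fun g => piFun x g φ) μ := integrable_piRep x μ φ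
  have hdisp : Continuous fun g => ‖piFun x g φ - φ‖ ^ 2 := (hc.sub continuous_const).norm.pow 2
  have h1 : energy (quotientLaw μ) x φ =
      ∫ p : Isom d × Isom d, ‖piFun x p.1 φ - piFun x p.2 φ‖ ^ 2 ∂μ.prod μ := by
    rw [energy, quotientLaw, integral_map continuous_quotient.measurable.aemeasurable
      hdisp.aestronglyMeasurable]
    refine integral_congr_ae (Filter.Eventually.of_forall fun p => ?_)
    have h := norm_piFun x p.2 (piFun x (p.2⁻¹ * p.1) φ - φ)
    rw [piFun_sub, ← piFun_mul, mul_inv_cancel_left] at h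
    simp only [h]
  have h2 (p : Isom d × Isom d) : ‖piFun x p.1 φ - piFun x p.2 φ‖ ^ 2 =
      2 * ‖φ‖ ^ 2 - 2 * RCLike.re (inner ℂ (piFun x p.1 φ) (piFun x p.2 φ)) := by
    rw [norm_sub_sq (𝕜 := ℂ), norm_piFun, norm_piFun]
    ring
  have hint2 : Integrable
      (fun p : Isom d × Isom d => inner ℂ (piFun x p.1 φ) (piFun x p.2 φ)) (μ.prod μ) := by
    refine Integrable.of_bound
      ((hc.comp continuous_fst).inner (hc.comp continuous_snd)).aestronglyMeasurable (‖φ‖ * ‖φ‖)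
      (Filter.Eventually.of_forall fun p => ?_)
    refine (norm_inner_le_norm _ _).trans_eq ?_
    rw [norm_piFun, norm_piFun]
  have h3 : ∫ p : Isom d × Isom d, inner ℂ (piFun x p.1 φ) (piFun x p.2 φ) ∂μ.prod μ =
      inner ℂ (piMeasure x μ φ) (piMeasure x μ φ) := by
    rw [integral_prod _ hint2]
    have h4 (g : Isom d) : ∫ h, inner ℂ (piFun x g φ) (piFun x h φ) ∂μ =
        (starRingEnd ℂ) (inner ℂ (piMeasure x μ φ) (piFun x g φ)) := by
      rw [integral_inner hint, inner_conj_symm]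
      rfl
    simp only [h4]
    rw [integral_conj, integral_inner hint, inner_conj_symm]
    rfl
  rw [h1]
  simp only [h2]
  have hre : ∫ p : Isom d × Isom d, RCLike.re (inner ℂ (piFun x p.1 φ) (piFun x p.2 φ)) ∂μ.prod μ =
      ‖piMeasure x μ φ‖ ^ 2 := by
    rw [← inner_self_eq_norm_sq (𝕜 := ℂ), ← h3]
    exact integral_re hint2
  rw [integral_sub (integrable_const _) (hint2.re.const_mul 2), integral_const, integral_const_mul, hre]
  simp

theorem gap_quotientLaw (μ : Measure (Isom d)) [IsProbabilityMeasure μ] {α : ℝ} (hα : 0 < α)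
    (hgap : ∀ φ ∈ L20 d, ‖piMeasure 0 μ φ‖ ≤ (1 - α) * ‖φ‖) :
    ∀ φ ∈ L20 d, α * ‖φ‖ ^ 2 ≤ energy (quotientLaw μ) 0 φ := by
  intro φ hφ
  have h := hgap φ hφ
  rw [energy_quotientLaw]
  have h0 := norm_nonneg (piMeasure 0 μ φ)
  have h1 : 0 ≤ ‖φ‖ := norm_nonneg φ
  have h2 : ‖piMeasure 0 μ φ‖ ^ 2 ≤ ((1 - α) * ‖φ‖) * ‖φ‖ := by
    have : (1 - α) * ‖φ‖ ≤ ‖φ‖ := by nlinarith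
    nlinarith
  nlinarith [mul_nonneg hα.le (sq_nonneg ‖φ‖)]

/-- If `h⁻¹ g` fixes `u` almost surely, then `g u = w` almost surely for one point `w`, by symmetry
also `g w = u`, and the midpoint of `u` and `w` is fixed. -/
theorem not_ae_quotientLaw_smul_eq (μ : Measure (Isom d)) [IsProbabilityMeasure μ]
    (hsymm : μ.map (fun g => g⁻¹) = μ) (hmove : ∀ x : E d, 0 < μ {g : Isom d | g • x ≠ x})
    (u : E d) : ¬ ∀ᵐ g ∂quotientLaw μ, g • u = u := by
  intro h
  have h1 : ∀ᵐ p ∂μ.prod μ, (p.2⁻¹ * p.1) • u = u :=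
    ae_of_ae_map continuous_quotient.measurable.aemeasurable h
  have h2 : ∀ᵐ g ∂μ, ∀ᵐ h ∂μ, (h⁻¹ * g) • u = u := Measure.ae_ae_of_ae_prod h1
  obtain ⟨g₀, hg₀⟩ := h2.exists
  have h3 : ∀ᵐ h ∂μ, h • u = g₀ • u := by
    filter_upwards [hg₀] with h hh
    rw [mul_smul, inv_smul_eq_iff] at hh
    exact hh.symm
  have h4 : ∀ᵐ h ∂μ, h⁻¹ • u = g₀ • u := by
    rw [← hsymm] at h3
    exact ae_of_ae_map continuous_inv.measurable.aemeasurable h3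
  refine (hmove ((1 / 2 : ℝ) • (u + g₀ • u))).ne' ?_
  refine ae_iff.1 ?_
  filter_upwards [h3, h4] with h h3 h4
  rw [inv_smul_eq_iff] at h4
  have h5 : h.v + rotate h.θ u = g₀ • u := h3
  have h6 : h.v + rotate h.θ (g₀ • u) = u := h4.symm
  rw [Isom.smul_def, rotate_smul, rotate_add]
  have h7 : h.v + (1 / 2 : ℝ) • (rotate h.θ u + rotate h.θ (g₀ • u)) =
      (1 / 2 : ℝ) • ((h.v + rotate h.θ u) + (h.v + rotate h.θ (g₀ • u))) := by
    module
  rw [h7, h5, h6, add_comm]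

/-! ### Low frequencies -/

theorem norm_e_sub_one_le (y : ℝ) : ‖e y - 1‖ ≤ 2 * Real.pi * |y| := by
  have h := Real.norm_exp_I_mul_ofReal_sub_one_le (x := -(2 * Real.pi * y))
  rw [norm_neg, norm_mul, norm_mul, Real.norm_of_nonneg Real.pi_pos.le, Real.norm_eq_abs y] at h
  rw [e, mul_comm, ← Complex.ofReal_neg]
  simpa using h

theorem norm_one_sub_e_sub_le (y : ℝ) :
    ‖1 - e y - (2 * Real.pi * y : ℝ) * Complex.I‖ ≤ 3 * (2 * Real.pi * y) ^ 2 := by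
  set t : ℝ := 2 * Real.pi * y with ht
  have hti : ‖(-(t : ℂ) * Complex.I)‖ = |t| := by simp
  have h0 : 1 - e y - t * Complex.I =
      -(Complex.exp (-(t : ℂ) * Complex.I) - 1 - (-(t : ℂ) * Complex.I)) := by
    rw [e, ← ht]
    ring
  rw [h0, norm_neg]
  rcases le_total |t| 1 with h | h
  · have := Complex.norm_exp_sub_one_sub_id_le (hti.trans_le h)
    rw [hti, sq_abs] at this
    nlinarith [sq_nonneg t]
  · have h1 := norm_sub_le (Complex.exp (-(t : ℂ) * Complex.I) - 1) (-(t : ℂ) * Complex.I)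
    have h2 := norm_sub_le (Complex.exp (-(t : ℂ) * Complex.I)) 1
    have h3 : ‖Complex.exp (-(t : ℂ) * Complex.I)‖ = 1 := norm_e y
    rw [h3, norm_one] at h2
    rw [hti] at h1
    nlinarith [sq_abs t]

/-- The mean of `φ` over `SO(d)`. -/
def mean (φ : L2 d) : ℂ := ∫ ω, φ ω ∂haarSO d

theorem integrable_L2 (φ : L2 d) : Integrable φ (haarSO d) :=
  (Lp.memLp φ).integrable (by norm_num)

theorem norm_const (c : ℂ) : ‖Lp.const 2 (haarSO d) c‖ = ‖c‖ := by
  rw [Lp.norm_const' _ _ _ two_ne_zero ENNReal.ofNat_ne_top, probReal_univ, Real.one_rpow, mul_one]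

theorem sub_const_mean_mem_L20 (φ : L2 d) : φ - Lp.const 2 (haarSO d) (mean φ) ∈ L20 d := by
  change ∫ ω, (φ - Lp.const 2 (haarSO d) (mean φ)) ω ∂haarSO d = 0
  have h : ∀ᵐ ω ∂haarSO d, (φ - Lp.const 2 (haarSO d) (mean φ)) ω = φ ω - mean φ := by
    filter_upwards [Lp.coeFn_sub φ (Lp.const 2 (haarSO d) (mean φ)),
      Lp.coeFn_const (p := 2) (μ := haarSO d) (mean φ)] with ω h1 h2
    rw [h1, Pi.sub_apply, h2, Function.const_apply]
  rw [integral_congr_ae h, integral_sub (integrable_L2 φ) (integrable_const _)]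
  simp [mean]

theorem piFun_zero_const (g : Isom d) (c : ℂ) :
    piFun 0 g (Lp.const 2 (haarSO d) c) = Lp.const 2 (haarSO d) c := by
  have hc := Lp.coeFn_const (p := 2) (μ := haarSO d) c
  refine Lp.ext ?_
  filter_upwards [piFun_ae 0 g (Lp.const 2 (haarSO d) c), hc,
    (measurePreserving_leftMul g.θ).quasiMeasurePreserving.ae hc] with ω h1 h2 h3
  change Lp.const 2 (haarSO d) c (g.θ⁻¹ * ω) = _ at h3
  rw [h1, h2, h3]
  simp [rotate_zero, e_zero]

/-- The spectral gap controls the distance to the constant functions. -/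
theorem norm_sub_const_mean_sq_le {ν : Measure (Isom d)} {α : ℝ}
    (hgap : ∀ φ ∈ L20 d, α * ‖φ‖ ^ 2 ≤ energy ν 0 φ) (φ : L2 d) :
    α * ‖φ - Lp.const 2 (haarSO d) (mean φ)‖ ^ 2 ≤ energy ν 0 φ := by
  refine (hgap _ (sub_const_mean_mem_L20 φ)).trans_eq ?_
  simp only [energy, piFun_sub, piFun_zero_const, sub_sub_sub_cancel_right]

theorem norm_piFun_sub_piFun_zero_le (x : E d) (g : Isom d) (φ : L2 d) :
    ‖piFun x g φ - piFun 0 g φ‖ ≤ min 2 (2 * Real.pi * (‖x‖ * ‖g.v‖)) * ‖φ‖ := by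
  rw [← norm_piFun 0 g φ]
  refine Lp.norm_le_mul_norm_of_ae_le_mul ?_
  filter_upwards [Lp.coeFn_sub (piFun x g φ) (piFun 0 g φ), piFun_ae x g φ, piFun_ae 0 g φ]
    with ω h1 h2 h3
  have h4 : piFun x g φ ω - piFun 0 g φ ω =
      (e (inner ℝ (rotate ω x) g.v) - 1) * piFun 0 g φ ω := by
    rw [h2, h3, rotate_zero, inner_zero_left, e_zero]
    ring
  rw [h1, Pi.sub_apply, h4, norm_mul]
  refine mul_le_mul_of_nonneg_right (le_min ?_ ?_) (norm_nonneg _)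
  · refine (norm_sub_le _ _).trans ?_
    rw [norm_e, norm_one]
    norm_num
  · refine (norm_e_sub_one_le _).trans ?_
    have h5 := abs_real_inner_le_norm (rotate ω x) g.v
    rw [norm_rotate] at h5
    have := Real.pi_pos
    gcongr

/-- A bound for the mean of `|e(⟨ω x, v⟩) - 1|²` at frequencies `|x| = r`. The truncation makes it
finite, and small for small `r`, without any moment assumption on `v`. -/
def oscillation (ν : Measure (Isom d)) (r : ℝ) : ℝ :=
  ∫ g : Isom d, min 2 (2 * Real.pi * (r * ‖g.v‖)) ^ 2 ∂ν

theorem continuous_oscillation_integrand (r : ℝ) :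
    Continuous fun g : Isom d => min 2 (2 * Real.pi * (r * ‖g.v‖)) ^ 2 :=
  (continuous_const.min (continuous_const.mul
    (continuous_const.mul Isom.continuous_v.norm))).pow 2

theorem oscillation_integrand_le {r t : ℝ} (hr : 0 ≤ r) (ht : 0 ≤ t) :
    ‖min 2 (2 * Real.pi * (r * t)) ^ 2‖ ≤ 4 := by
  have := Real.pi_pos
  rw [norm_pow, Real.norm_of_nonneg (le_min (by norm_num) (by positivity))]
  have h : min 2 (2 * Real.pi * (r * t)) ≤ 2 := min_le_left _ _
  have h0 : 0 ≤ min 2 (2 * Real.pi * (r * t)) := le_min (by norm_num) (by positivity)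
  nlinarith

theorem integrable_oscillation (ν : Measure (Isom d)) [IsProbabilityMeasure ν] {r : ℝ}
    (hr : 0 ≤ r) : Integrable (fun g : Isom d => min 2 (2 * Real.pi * (r * ‖g.v‖)) ^ 2) ν :=
  Integrable.of_bound (continuous_oscillation_integrand r).aestronglyMeasurable 4
    (Filter.Eventually.of_forall fun _ => oscillation_integrand_le hr (norm_nonneg _))

theorem exists_oscillation_le (ν : Measure (Isom d)) [IsProbabilityMeasure ν] {ε : ℝ}
    (hε : 0 < ε) : ∃ r₀ : ℝ, 0 < r₀ ∧ ∀ r, 0 ≤ r → r ≤ r₀ → oscillation ν r ≤ ε := by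
  have hlim : Filter.Tendsto (fun r => oscillation ν |r|) (nhds 0) (nhds 0) := by
    have h0 : ∫ g : Isom d, (0 : ℝ) ∂ν = 0 := integral_zero _ _
    rw [← h0]
    refine tendsto_integral_filter_of_dominated_convergence (fun _ => 4)
      (Filter.Eventually.of_forall fun r =>
        (continuous_oscillation_integrand |r|).aestronglyMeasurable)
      (Filter.Eventually.of_forall fun r => Filter.Eventually.of_forall fun g =>
        oscillation_integrand_le (abs_nonneg r) (norm_nonneg _))
      (integrable_const _) (Filter.Eventually.of_forall fun g => ?_)
    have hc : Continuous fun r : ℝ => min 2 (2 * Real.pi * (|r| * ‖g.v‖)) ^ 2 := by fun_prop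
    simpa using hc.tendsto 0
  obtain ⟨r₁, hr₁, h⟩ := Metric.eventually_nhds_iff.1 (hlim.eventually (gt_mem_nhds hε))
  refine ⟨r₁ / 2, by positivity, fun r hr hr' => ?_⟩
  have := h (y := r) (by rw [Real.dist_eq, sub_zero, abs_of_nonneg hr]; linarith)
  rw [abs_of_nonneg hr] at this
  exact this.le

theorem energy_zero_le (ν : Measure (Isom d)) [IsProbabilityMeasure ν] (x : E d) (φ : L2 d) :
    energy ν 0 φ ≤ 2 * energy ν x φ + 2 * (oscillation ν ‖x‖ * ‖φ‖ ^ 2) := by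
  have hi := (integrable_oscillation ν (norm_nonneg x)).mul_const (‖φ‖ ^ 2)
  rw [energy, energy, oscillation, ← integral_mul_const, ← integral_const_mul, ← integral_const_mul,
    ← integral_add ((integrable_energy ν x φ).const_mul 2) (hi.const_mul 2)]
  refine integral_mono (integrable_energy ν 0 φ)
    (((integrable_energy ν x φ).const_mul 2).add (hi.const_mul 2)) fun g => ?_
  have h1 := norm_piFun_sub_piFun_zero_le x g φ
  have h2 : ‖piFun 0 g φ - φ‖ ≤ ‖piFun x g φ - φ‖ + ‖piFun x g φ - piFun 0 g φ‖ := by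
    rw [norm_sub_rev (piFun x g φ) (piFun 0 g φ), add_comm]
    exact norm_sub_le_norm_sub_add_norm_sub _ _ _
  have h3 := norm_nonneg (piFun 0 g φ - φ)
  have h4 := pow_le_pow_left₀ (norm_nonneg (piFun x g φ - piFun 0 g φ)) h1 2
  rw [mul_pow] at h4
  nlinarith [sq_nonneg (‖piFun x g φ - φ‖ - ‖piFun x g φ - piFun 0 g φ‖)]

theorem integral_norm_le_norm (φ : L2 d) : ∫ ω, ‖φ ω‖ ∂haarSO d ≤ ‖φ‖ := by
  rw [integral_norm_eq_lintegral_enorm (Lp.aestronglyMeasurable φ), ← eLpNorm_one_eq_lintegral_enorm,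
    Lp.norm_def]
  exact ENNReal.toReal_mono (Lp.eLpNorm_ne_top φ)
    (eLpNorm_le_eLpNorm_of_exponent_le (by norm_num) (Lp.aestronglyMeasurable φ))

theorem norm_mean_le (φ : L2 d) : ‖mean φ‖ ≤ ‖φ‖ :=
  (norm_integral_le_integral_norm _).trans (integral_norm_le_norm φ)

theorem integral_norm_comp_mul_left (θ : SO d) (φ : L2 d) :
    ∫ ω, ‖φ (θ⁻¹ * ω)‖ ∂haarSO d = ∫ ω, ‖φ ω‖ ∂haarSO d :=
  integral_mul_left_eq_self (fun ω => ‖φ ω‖) θ⁻¹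

/-- The first-order part of `φ` in the direction of the linear functions `ω ↦ ⟪ω x, ·⟫`, as a vector
of `ℝ^d`. The factor `conj (mean φ)` rotates the mean of `φ` to the real axis. -/
def firstMoment (x : E d) (φ : L2 d) : E d :=
  ∫ ω, ((starRingEnd ℂ) (mean φ) * φ ω).im • rotate ω x ∂haarSO d

theorem integrable_mul_L2_im (c : ℂ) (φ : L2 d) :
    Integrable (fun ω => (c * φ ω).im) (haarSO d) :=
  ((integrable_L2 φ).const_mul c).im

theorem integrable_smul_rotate {s : SO d → ℝ} (hs : Integrable s (haarSO d)) (x : E d) :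
    Integrable (fun ω => s ω • rotate ω x) (haarSO d) :=
  hs.smul_bdd ‖x‖ (continuous_rotate_left x).aestronglyMeasurable
    (Filter.Eventually.of_forall fun ω => (norm_rotate ω x).le)

theorem rotate_firstMoment (θ : SO d) (x : E d) (φ : L2 d) :
    rotate θ (firstMoment x φ) =
      ∫ ω, ((starRingEnd ℂ) (mean φ) * φ (θ⁻¹ * ω)).im • rotate ω x ∂haarSO d := by
  have h1 := (rotateIsometry θ).toContinuousLinearMap.integral_comp_comm
    (integrable_smul_rotate (integrable_mul_L2_im ((starRingEnd ℂ) (mean φ)) φ) x)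
  change _ = rotate θ (firstMoment x φ) at h1
  rw [← h1, ← integral_mul_left_eq_self _ θ⁻¹]
  refine integral_congr_ae (Filter.Eventually.of_forall fun ω => ?_)
  change rotate θ (_ • rotate (θ⁻¹ * ω) x) = _
  rw [rotate_smul, ← rotate_mul, mul_inv_cancel_left]

/-- Up to second-order errors, an almost invariant and almost constant `φ` has a first moment that is
almost fixed by the affine map `A ↦ θ A - κ v`; the factor `1/d` is the second moment of the sphere. -/
theorem norm_rotate_firstMoment_sub_le (hd : 2 ≤ d) {x : E d} (hx : x ≠ 0) (g : Isom d)
    {φ : L2 d} (hφ : ‖φ‖ ≤ 1) :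
    ‖rotate g.θ (firstMoment (‖x‖⁻¹ • x) φ) - firstMoment (‖x‖⁻¹ • x) φ -
        (2 * Real.pi * ‖mean φ‖ ^ 2 * ‖x‖ / d) • g.v‖ ≤
      ‖piFun x g φ - φ‖ + 3 * (2 * Real.pi * (‖x‖ * ‖g.v‖)) ^ 2 +
        2 * Real.pi * (‖x‖ * ‖g.v‖) * ‖φ - Lp.const 2 (haarSO d) (mean φ)‖ := by
  set z : E d := ‖x‖⁻¹ • x with hz
  set c : ℂ := mean φ with hc
  set ψ : L2 d := φ - Lp.const 2 (haarSO d) c with hψ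
  have hpi := Real.pi_pos
  have hx0 : ‖x‖ ≠ 0 := norm_ne_zero_iff.2 hx
  have hz1 : ‖z‖ = 1 := norm_smul_inv_norm hx
  have hxz : x = ‖x‖ • z := by rw [hz, smul_smul, mul_inv_cancel₀ hx0, one_smul]
  have hc1 : ‖c‖ ≤ 1 := (norm_mean_le φ).trans hφ
  set y : SO d → ℝ := fun ω => inner ℝ (rotate ω x) g.v with hy
  have hyc : Continuous y := (continuous_rotate_left x).inner continuous_const
  have hyb (ω : SO d) : |y ω| ≤ ‖x‖ * ‖g.v‖ := by
    have := abs_real_inner_le_norm (rotate ω x) g.v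
    rwa [norm_rotate] at this
  -- all three vectors are integrals of multiples of `ω ↦ ω z`
  have hv : (2 * Real.pi * ‖c‖ ^ 2 * ‖x‖ / d) • g.v =
      ∫ ω, (2 * Real.pi * ‖c‖ ^ 2 * y ω) • rotate ω z ∂haarSO d := by
    have h1 : (2 * Real.pi * ‖c‖ ^ 2 * ‖x‖ / d) • g.v =
        (2 * Real.pi * ‖c‖ ^ 2 * ‖x‖) • ((d : ℝ)⁻¹ • g.v) := by
      rw [smul_smul, div_eq_mul_inv]
    rw [h1, ← integral_inner_rotate_smul hd hz1, ← integral_smul]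
    refine integral_congr_ae (Filter.Eventually.of_forall fun ω => ?_)
    have h2 : y ω = ‖x‖ * inner ℝ (rotate ω z) g.v := by
      change inner ℝ (rotate ω x) g.v = _
      conv_lhs => rw [hxz, rotate_smul, inner_smul_left, conj_trivial]
    simp only [h2, smul_smul]
    congr 1
    ring
  have hi1 : Integrable (fun ω => ((starRingEnd ℂ) c * φ (g.θ⁻¹ * ω)).im) (haarSO d) :=
    (integrable_mul_L2_im ((starRingEnd ℂ) c) φ).comp_mul_left g.θ⁻¹
  have hi2 : Integrable (fun ω => ((starRingEnd ℂ) c * φ ω).im) (haarSO d) :=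
    integrable_mul_L2_im ((starRingEnd ℂ) c) φ
  have hi3 : Integrable (fun ω => 2 * Real.pi * ‖c‖ ^ 2 * y ω) (haarSO d) :=
    integrable_of_continuous (continuous_const.mul hyc)
  have hi4 := (integrable_L2 (piFun x g φ - φ)).norm
  have hi5 := ((integrable_L2 φ).comp_mul_left g.θ⁻¹).norm
  have hi6 := ((integrable_L2 ψ).comp_mul_left g.θ⁻¹).norm
  have hi7 : Integrable (fun ω => ((starRingEnd ℂ) c * φ (g.θ⁻¹ * ω)).im • rotate ω z -
      ((starRingEnd ℂ) c * φ ω).im • rotate ω z) (haarSO d) :=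
    (integrable_smul_rotate hi1 z).sub (integrable_smul_rotate hi2 z)
  rw [rotate_firstMoment, firstMoment, hv, ← integral_sub (integrable_smul_rotate hi1 z)
    (integrable_smul_rotate hi2 z), ← integral_sub hi7 (integrable_smul_rotate hi3 z)]
  have hi8 : Integrable (fun ω => ‖(piFun x g φ - φ) ω‖ +
      3 * (2 * Real.pi * (‖x‖ * ‖g.v‖)) ^ 2 * ‖φ (g.θ⁻¹ * ω)‖) (haarSO d) :=
    hi4.add (hi5.const_mul _)
  have hi9 : Integrable (fun ω => ‖(piFun x g φ - φ) ω‖ +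
      3 * (2 * Real.pi * (‖x‖ * ‖g.v‖)) ^ 2 * ‖φ (g.θ⁻¹ * ω)‖ +
      2 * Real.pi * (‖x‖ * ‖g.v‖) * ‖ψ (g.θ⁻¹ * ω)‖) (haarSO d) :=
    hi8.add (hi6.const_mul _)
  have hbound : ∫ ω, (‖(piFun x g φ - φ) ω‖ +
        3 * (2 * Real.pi * (‖x‖ * ‖g.v‖)) ^ 2 * ‖φ (g.θ⁻¹ * ω)‖ +
        2 * Real.pi * (‖x‖ * ‖g.v‖) * ‖ψ (g.θ⁻¹ * ω)‖) ∂haarSO d ≤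
      ‖piFun x g φ - φ‖ + 3 * (2 * Real.pi * (‖x‖ * ‖g.v‖)) ^ 2 +
        2 * Real.pi * (‖x‖ * ‖g.v‖) * ‖ψ‖ := by
    rw [integral_add hi8 (hi6.const_mul _), integral_add hi4 (hi5.const_mul _),
      integral_const_mul, integral_const_mul, integral_norm_comp_mul_left,
      integral_norm_comp_mul_left]
    have h1 := integral_norm_le_norm (piFun x g φ - φ)
    have h2 := integral_norm_le_norm ψ
    have h3 := (integral_norm_le_norm φ).trans hφ
    have h4 : 3 * (2 * Real.pi * (‖x‖ * ‖g.v‖)) ^ 2 * ∫ ω, ‖φ ω‖ ∂haarSO d ≤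
        3 * (2 * Real.pi * (‖x‖ * ‖g.v‖)) ^ 2 := mul_le_of_le_one_right (by positivity) h3
    gcongr
  refine (norm_integral_le_of_norm_le hi9 ?_).trans hbound
  have hψae : ∀ᵐ ω ∂haarSO d, ψ ω = φ ω - c := by
    filter_upwards [Lp.coeFn_sub φ (Lp.const 2 (haarSO d) c),
      Lp.coeFn_const (p := 2) (μ := haarSO d) c] with ω h1 h2
    rw [hψ, h1, Pi.sub_apply, h2, Function.const_apply]
  filter_upwards [Lp.coeFn_sub (piFun x g φ) φ, piFun_ae x g φ,
    (measurePreserving_leftMul g.θ).quasiMeasurePreserving.ae hψae] with ω h1 h2 h3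
  change ψ (g.θ⁻¹ * ω) = φ (g.θ⁻¹ * ω) - c at h3
  change _ = e (y ω) * _ at h2
  rw [h1, Pi.sub_apply, h2, h3, ← sub_smul, ← sub_smul, norm_smul, norm_rotate, hz1, mul_one]
  generalize φ (g.θ⁻¹ * ω) = a
  generalize φ ω = b
  -- with `t = 2πy`: `a - b = (e(y)a - b) + (1 - e(y) - it)a + it(a - c) + itc`
  set t : ℝ := 2 * Real.pi * y ω with ht
  have hsplit : ((starRingEnd ℂ) c * a).im - ((starRingEnd ℂ) c * b).im -
      2 * Real.pi * ‖c‖ ^ 2 * y ω =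
      ((starRingEnd ℂ) c * ((e (y ω) * a - b) + (1 - e (y ω) - t * Complex.I) * a +
        t * Complex.I * (a - c))).im := by
    have h4 : ((starRingEnd ℂ) c * (t * Complex.I * c)).im = 2 * Real.pi * ‖c‖ ^ 2 * y ω := by
      have h5 : (starRingEnd ℂ) c * (t * Complex.I * c) = ((‖c‖ ^ 2 * t : ℝ) : ℂ) * Complex.I := by
        rw [Complex.ofReal_mul (‖c‖ ^ 2) t, Complex.ofReal_pow, ← Complex.conj_mul']
        ring
      rw [h5, Complex.im_ofReal_mul, Complex.I_im, ht]
      ring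
    rw [← h4, ← Complex.sub_im, ← Complex.sub_im]
    congr 1
    ring
  have ht1 : |t| ≤ 2 * Real.pi * (‖x‖ * ‖g.v‖) := by
    rw [ht, abs_mul, abs_of_pos (by positivity)]
    have := hyb ω
    gcongr
  have ht2 : t ^ 2 ≤ (2 * Real.pi * (‖x‖ * ‖g.v‖)) ^ 2 := by
    rw [← sq_abs t]
    exact pow_le_pow_left₀ (abs_nonneg t) ht1 2
  rw [hsplit]
  refine (Complex.abs_im_le_norm _).trans ?_
  rw [norm_mul, Complex.norm_conj]
  refine (mul_le_of_le_one_left (norm_nonneg _) hc1).trans ((norm_add₃_le).trans ?_)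
  rw [norm_mul, norm_mul, norm_mul, Complex.norm_I, mul_one, Complex.norm_real, Real.norm_eq_abs]
  have h6 : ‖1 - e (y ω) - t * Complex.I‖ ≤ 3 * (2 * Real.pi * (‖x‖ * ‖g.v‖)) ^ 2 :=
    (norm_one_sub_e_sub_le (y ω)).trans (by gcongr)
  gcongr

/-- The lower bound on displacements, applied to a multiple of the first moment of `φ`. -/
theorem le_energy_add_of_displacement (hd : 2 ≤ d) (ν : Measure (Isom d)) [IsProbabilityMeasure ν]
    {δ : ℝ}
    (hδ : ∀ u : E d, δ ≤ ∫ g : Isom d, (‖g • u - u‖ / (1 + ‖g.v‖ ^ 2)) ^ 2 ∂ν)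
    {x : E d} (hx : x ≠ 0) {φ : L2 d} (hφ : ‖φ‖ ≤ 1) (hm : mean φ ≠ 0) :
    (2 * Real.pi * ‖mean φ‖ ^ 2 * ‖x‖ / d) ^ 2 * δ ≤ 3 * (energy ν x φ +
      (3 * (2 * Real.pi * ‖x‖) ^ 2) ^ 2 +
        (2 * Real.pi * ‖x‖ * ‖φ - Lp.const 2 (haarSO d) (mean φ)‖) ^ 2) := by
  set κ : ℝ := 2 * Real.pi * ‖mean φ‖ ^ 2 * ‖x‖ / d with hκ
  set B : ℝ := ‖φ - Lp.const 2 (haarSO d) (mean φ)‖ with hB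
  set A : E d := firstMoment (‖x‖⁻¹ • x) φ with hA
  have hpi := Real.pi_pos
  have hκ0 : 0 < κ := by
    have : 0 < d := by omega
    have := norm_pos_iff.2 hx
    have := norm_pos_iff.2 hm
    positivity
  set u : E d := -(κ⁻¹ • A) with hu
  have hB0 : 0 ≤ B := norm_nonneg _
  have hkey (g : Isom d) : κ ^ 2 * (‖g • u - u‖ / (1 + ‖g.v‖ ^ 2)) ^ 2 ≤
      3 * (‖piFun x g φ - φ‖ ^ 2 + (3 * (2 * Real.pi * ‖x‖) ^ 2) ^ 2 +
        (2 * Real.pi * ‖x‖ * B) ^ 2) := by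
    have h1 : rotate g.θ A - A - κ • g.v = -(κ • (g • u - u)) := by
      have h2 : A = -(κ • u) := by
        rw [hu, smul_neg, neg_neg, smul_smul, mul_inv_cancel₀ hκ0.ne', one_smul]
      rw [Isom.smul_def, h2, rotate_neg, rotate_smul]
      module
    have h3 := norm_rotate_firstMoment_sub_le hd hx g hφ
    rw [h1, norm_neg, norm_smul, Real.norm_of_nonneg hκ0.le] at h3
    set a : ℝ := ‖piFun x g φ - φ‖ with ha
    have ha0 : 0 ≤ a := norm_nonneg _
    have h4 : κ * (‖g • u - u‖ / (1 + ‖g.v‖ ^ 2)) ≤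
        a + 3 * (2 * Real.pi * ‖x‖) ^ 2 + 2 * Real.pi * ‖x‖ * B := by
      rw [← mul_div_assoc, div_le_iff₀ (by positivity)]
      refine h3.trans ?_
      have h5 : ‖g.v‖ ≤ 1 + ‖g.v‖ ^ 2 := by nlinarith [sq_nonneg (‖g.v‖ - 1), norm_nonneg g.v]
      have h6 : 2 * Real.pi * ‖x‖ * B * ‖g.v‖ ≤ 2 * Real.pi * ‖x‖ * B * (1 + ‖g.v‖ ^ 2) := by
        gcongr
      have h7 : 0 ≤ a * ‖g.v‖ ^ 2 := by positivity
      have h8 : 0 ≤ 3 * (2 * Real.pi * ‖x‖) ^ 2 := by positivity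
      linarith [mul_pow (2 * Real.pi * ‖x‖) ‖g.v‖ 2]
    have h9 : 0 ≤ κ * (‖g • u - u‖ / (1 + ‖g.v‖ ^ 2)) := by positivity
    rw [← mul_pow]
    refine (pow_le_pow_left₀ h9 h4 2).trans ?_
    generalize 3 * (2 * Real.pi * ‖x‖) ^ 2 = b
    generalize 2 * Real.pi * ‖x‖ * B = c
    linarith [sq_nonneg (a - b), sq_nonneg (a - c), sq_nonneg (b - c)]
  have hi := integrable_energy ν x φ
  calc κ ^ 2 * δ ≤ κ ^ 2 * ∫ g : Isom d, (‖g • u - u‖ / (1 + ‖g.v‖ ^ 2)) ^ 2 ∂ν :=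
        mul_le_mul_of_nonneg_left (hδ u) (by positivity)
    _ = ∫ g : Isom d, κ ^ 2 * (‖g • u - u‖ / (1 + ‖g.v‖ ^ 2)) ^ 2 ∂ν :=
        (integral_const_mul _ _).symm
    _ ≤ ∫ g : Isom d, 3 * (‖piFun x g φ - φ‖ ^ 2 + (3 * (2 * Real.pi * ‖x‖) ^ 2) ^ 2 +
        (2 * Real.pi * ‖x‖ * B) ^ 2) ∂ν :=
        integral_mono_of_nonneg (Filter.Eventually.of_forall fun g => by positivity)
          (((hi.add (integrable_const _)).add (integrable_const _)).const_mul 3)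
          (Filter.Eventually.of_forall hkey)
    _ = _ := by
        have hi' : Integrable
            (fun g => ‖piFun x g φ - φ‖ ^ 2 + (3 * (2 * Real.pi * ‖x‖) ^ 2) ^ 2) ν :=
          hi.add (integrable_const _)
        rw [integral_const_mul, integral_add hi' (integrable_const _),
          integral_add hi (integrable_const _)]
        simp [energy]

/-- For small `x`, either `φ` is far from constant, and the spectral gap bounds its energy from below
by a constant, or it is close to a constant, and the displacement of its first moment bounds the
energy by a multiple of `‖x‖²`. -/
theorem exists_le_energy_of_norm_le (hd : 2 ≤ d) (ν : Measure (Isom d)) [IsProbabilityMeasure ν]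
    {α : ℝ} (hα : 0 < α) (hgap : ∀ φ ∈ L20 d, α * ‖φ‖ ^ 2 ≤ energy ν 0 φ)
    (hν : ∀ u : E d, ¬ ∀ᵐ g ∂ν, g • u = u) :
    ∃ r₀ : ℝ, 0 < r₀ ∧ r₀ ≤ 1 ∧ ∃ c₁ : ℝ, 0 < c₁ ∧
      ∀ x : E d, ‖x‖ ≤ r₀ → ∀ φ : L2 d, ‖φ‖ = 1 → c₁ * ‖x‖ ^ 2 ≤ energy ν x φ := by
  obtain ⟨δ, hδ0, hδ⟩ := exists_le_integral_displacement ν hν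
  have hpi := Real.pi_pos
  have hd0 : (0 : ℝ) < d := by exact_mod_cast (by omega : 0 < d)
  set D : ℝ := δ / d ^ 2 with hD
  have hD0 : 0 < D := by positivity
  set q : ℝ := (2 * Real.pi) ^ 2 with hq
  have hq0 : 0 < q := by positivity
  obtain ⟨r₁, hr₁, hosc⟩ := exists_oscillation_le ν
    (ε := min (α / 16) (D * α / (24 * q))) (by positivity)
  set r₂ : ℝ := √(D / (108 * q ^ 2)) with hr₂
  have hr₂0 : 0 < r₂ := Real.sqrt_pos.2 (by positivity)
  have hr₂sq : r₂ ^ 2 = D / (108 * q ^ 2) := Real.sq_sqrt (by positivity)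
  refine ⟨min 1 (min r₁ r₂), by positivity, min_le_left _ _,
    min (α / 16) (D / 2 / (3 + 6 * q / α)), by positivity, fun x hx φ hφ => ?_⟩
  have hx1 : ‖x‖ ≤ 1 := hx.trans (min_le_left _ _)
  have hxr₁ : ‖x‖ ≤ r₁ := hx.trans ((min_le_right _ _).trans (min_le_left _ _))
  have hxr₂ : ‖x‖ ≤ r₂ := hx.trans ((min_le_right _ _).trans (min_le_right _ _))
  have hE0 := energy_nonneg ν x φ
  rcases eq_or_ne x 0 with rfl | hx0
  · simpa using hE0
  have hη1 := (hosc ‖x‖ (norm_nonneg x) hxr₁).trans (min_le_left _ _)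
  have hη2 := (hosc ‖x‖ (norm_nonneg x) hxr₁).trans (min_le_right _ _)
  have hB := (norm_sub_const_mean_sq_le hgap φ).trans (energy_zero_le ν x φ)
  have hdisp := le_energy_add_of_displacement hd ν hδ hx0 hφ.le
  rw [hφ, one_pow, mul_one] at hB
  have htri : 1 - ‖mean φ‖ ≤ ‖φ - Lp.const 2 (haarSO d) (mean φ)‖ := by
    have := norm_sub_norm_le φ (Lp.const 2 (haarSO d) (mean φ))
    rwa [hφ, norm_const] at this
  set B : ℝ := ‖φ - Lp.const 2 (haarSO d) (mean φ)‖
  set X : ℝ := ‖x‖ ^ 2 with hX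
  have hX0 : 0 ≤ X := by positivity
  have hX1 : X ≤ 1 := pow_le_one₀ (norm_nonneg x) hx1
  have hB0 : 0 ≤ B := norm_nonneg _
  rcases le_or_gt B (1 / 2) with hB1 | hB1
  · have hm : 1 / 2 ≤ ‖mean φ‖ := by linarith
    have h1 := hdisp (norm_pos_iff.1 (by linarith))
    have h2 : X * D ≤ (2 * Real.pi * ‖mean φ‖ ^ 2 * ‖x‖ / d) ^ 2 * δ := by
      have h3 : 1 ≤ 2 * Real.pi * ‖mean φ‖ ^ 2 := by nlinarith [Real.pi_gt_three]
      have h4 : 1 * X ≤ (2 * Real.pi * ‖mean φ‖ ^ 2) ^ 2 * X :=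
        mul_le_mul_of_nonneg_right (one_le_pow₀ h3) hX0
      calc X * D ≤ (2 * Real.pi * ‖mean φ‖ ^ 2) ^ 2 * X * D := by
            rw [one_mul] at h4
            gcongr
        _ = _ := by
            rw [hD, hX]
            ring
    have h5 : (3 * (2 * Real.pi * ‖x‖) ^ 2) ^ 2 = 9 * q ^ 2 * X * X := by
      rw [hq, hX]
      ring
    have h6 : (2 * Real.pi * ‖x‖ * B) ^ 2 = q * X * B ^ 2 := by
      rw [hq, hX]
      ring
    rw [h5, h6] at h1
    have h7 : 9 * q ^ 2 * X * X ≤ D / 12 * X := by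
      refine mul_le_mul_of_nonneg_right ?_ hX0
      have h8 : X ≤ D / (108 * q ^ 2) := by
        rw [← hr₂sq]
        exact pow_le_pow_left₀ (norm_nonneg x) hxr₂ 2
      rw [le_div_iff₀ (by positivity)] at h8
      linarith
    have h9 : q * X * B ^ 2 ≤ 2 * q / α * energy ν x φ + D / 12 * X := by
      have h10 : q * B ^ 2 ≤ 2 * q / α * energy ν x φ + D / 12 := by
        rw [le_div_iff₀ (by positivity)] at hη2
        have h11 : q * B ^ 2 * α ≤ (2 * q / α * energy ν x φ + D / 12) * α := by
          have h12 : (2 * q / α * energy ν x φ + D / 12) * α =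
            2 * q * energy ν x φ + D / 12 * α := by field_simp
          rw [h12]
          nlinarith
        exact le_of_mul_le_mul_right h11 hα
      have h13 := mul_le_mul_of_nonneg_right h10 hX0
      have h14 : 2 * q / α * energy ν x φ * X ≤ 2 * q / α * energy ν x φ :=
        mul_le_of_le_one_right (by positivity) hX1
      linarith
    refine (mul_le_mul_of_nonneg_right (min_le_right _ _) hX0).trans ?_
    rw [div_mul_eq_mul_div, div_le_iff₀ (by positivity)]
    have h15 : energy ν x φ * (3 + 6 * q / α) =
      3 * energy ν x φ + 3 * (2 * q / α * energy ν x φ) := by ring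
    rw [h15]
    linarith
  · -- far from the constants the spectral gap alone gives a lower bound
    refine (mul_le_mul_of_nonneg_right (min_le_left _ _) hX0).trans ?_
    have h1 : 1 / 4 ≤ B ^ 2 := by nlinarith
    nlinarith

/-! ### High frequencies and unimodular functions -/

theorem norm_eq_one_of_ae_norm_eq_one {φ : L2 d} (h : ∀ᵐ ω ∂haarSO d, ‖φ ω‖ = 1) : ‖φ‖ = 1 := by
  have h1 : ‖φ‖ ^ 2 = 1 := by
    have h2 : (fun ω => ‖φ ω‖ ^ 2) =ᵐ[haarSO d] fun _ => 1 := by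
      filter_upwards [h] with ω hω
      rw [hω, one_pow]
    rw [norm_sq_eq_integral, integral_congr_ae h2]
    simp
  exact (pow_eq_one_iff_of_nonneg (norm_nonneg φ) two_ne_zero).1 h1

theorem norm_mul_conj_sub_mul_conj_le {a b a' b' : ℂ} (ha : ‖a'‖ = 1) (hb : ‖b‖ = 1) :
    ‖a * (starRingEnd ℂ) a' - b * (starRingEnd ℂ) b'‖ ≤ ‖a - b‖ + ‖a' - b'‖ := by
  have h : a * (starRingEnd ℂ) a' - b * (starRingEnd ℂ) b' =
      (a - b) * (starRingEnd ℂ) a' + b * (starRingEnd ℂ) (a' - b') := by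
    rw [map_sub]
    ring
  rw [h]
  refine (norm_add_le _ _).trans_eq ?_
  rw [norm_mul, norm_mul, Complex.norm_conj, Complex.norm_conj, ha, hb, mul_one, one_mul]

theorem e_conj (y : ℝ) : (starRingEnd ℂ) (e y) = e (-y) := by
  rw [e, e, ← Complex.exp_conj, map_mul, map_neg, Complex.conj_ofReal, Complex.conj_I]
  congr 1
  push_cast
  ring

/-- The product `ω ↦ φ(ω) conj φ(ωk)` of a unimodular `φ` with a right translate of its conjugate
transforms under `π_{x - kx}` as `φ` transforms under `π_x`. -/
theorem exists_energy_sub_rotate_le (ν : Measure (Isom d)) [IsProbabilityMeasure ν] (x : E d)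
    (k : SO d) {φ : L2 d} (hφ : ∀ᵐ ω ∂haarSO d, ‖φ ω‖ = 1) :
    ∃ F : L2 d, ‖F‖ = 1 ∧ energy ν (x - rotate k x) F ≤ 4 * energy ν x φ := by
  have hk : MeasurePreserving (fun ω : SO d => ω * k) (haarSO d) (haarSO d) :=
    measurePreserving_mul_right (haarSO d) k
  have hφk := hk.quasiMeasurePreserving.ae hφ
  have hmeas : AEStronglyMeasurable (fun ω => φ ω * (starRingEnd ℂ) (φ (ω * k))) (haarSO d) :=
    (Lp.aestronglyMeasurable φ).mul (Complex.continuous_conj.comp_aestronglyMeasurable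
      ((Lp.aestronglyMeasurable φ).comp_measurePreserving hk))
  have hmem : MemLp (fun ω => φ ω * (starRingEnd ℂ) (φ (ω * k))) 2 (haarSO d) := by
    refine MemLp.of_bound hmeas 1 ?_
    filter_upwards [hφ, hφk] with ω h1 h2
    rw [norm_mul, Complex.norm_conj, h1, h2, mul_one]
  set F : L2 d := hmem.toLp _ with hF
  have hFae := hmem.coeFn_toLp
  refine ⟨F, norm_eq_one_of_ae_norm_eq_one ?_, ?_⟩
  · filter_upwards [hFae, hφ, hφk] with ω h1 h2 h3
    rw [h1, norm_mul, Complex.norm_conj, h2, h3, mul_one]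
  have hpt (g : Isom d) : ‖piFun (x - rotate k x) g F - F‖ ≤ 2 * ‖piFun x g φ - φ‖ := by
    set D : Lp ℝ 2 (haarSO d) := (Lp.memLp (piFun x g φ - φ)).norm.toLp _ with hD
    have hDn : ‖D‖ = ‖piFun x g φ - φ‖ := by
      rw [hD, Lp.norm_toLp, eLpNorm_norm, Lp.norm_def]
    set Dk : Lp ℝ 2 (haarSO d) := Lp.compMeasurePreserving _ hk D with hDk
    have hDkn : ‖Dk‖ = ‖piFun x g φ - φ‖ := by
      rw [hDk, Lp.norm_compMeasurePreserving, hDn]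
    have hle : ‖piFun (x - rotate k x) g F - F‖ ≤ ‖D + Dk‖ := by
      refine Lp.norm_le_norm_of_ae_le ?_
      have hdiff : ∀ᵐ ω ∂haarSO d, D ω = ‖e (inner ℝ (rotate ω x) g.v) * φ (g.θ⁻¹ * ω) - φ ω‖ := by
        filter_upwards [(Lp.memLp (piFun x g φ - φ)).norm.coeFn_toLp,
          Lp.coeFn_sub (piFun x g φ) φ, piFun_ae x g φ] with ω h1 h2 h3
        rw [h1, h2, Pi.sub_apply, h3]
      have hleft := (measurePreserving_leftMul g.θ).quasiMeasurePreserving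
      filter_upwards [Lp.coeFn_sub (piFun (x - rotate k x) g F) F, Lp.coeFn_add D Dk, hFae,
        piFun_ae (x - rotate k x) g F, hleft.ae hFae, hdiff, hk.quasiMeasurePreserving.ae hdiff,
        Lp.coeFn_compMeasurePreserving D hk, hφ, hleft.ae hφk] with ω h1 h2 h3 h4 h5 h6 h7 h8 h9 h10
      change F (g.θ⁻¹ * ω) = φ (g.θ⁻¹ * ω) * (starRingEnd ℂ) (φ (g.θ⁻¹ * ω * k)) at h5
      change ‖φ (g.θ⁻¹ * ω * k)‖ = 1 at h10
      have h11 : Dk ω = D (ω * k) := h8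
      have h12 : e (inner ℝ (rotate ω (x - rotate k x)) g.v) =
          e (inner ℝ (rotate ω x) g.v) * (starRingEnd ℂ) (e (inner ℝ (rotate (ω * k) x) g.v)) := by
        rw [e_conj, ← e_add, rotate_sub, inner_sub_left, rotate_mul, sub_eq_add_neg]
      rw [h1, Pi.sub_apply, h4, h5, h3, h2, Pi.add_apply, h11, h6, h7,
        Real.norm_of_nonneg (by positivity), h12, ← mul_assoc g.θ⁻¹ ω k]
      have h13 := norm_mul_conj_sub_mul_conj_le
        (a := e (inner ℝ (rotate ω x) g.v) * φ (g.θ⁻¹ * ω)) (b := φ ω)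
        (a' := e (inner ℝ (rotate (ω * k) x) g.v) * φ (g.θ⁻¹ * ω * k)) (b' := φ (ω * k))
        (by rw [norm_mul, norm_e, h10, mul_one]) h9
      refine (le_of_eq ?_).trans h13
      rw [map_mul]
      congr 1
      ring
    refine hle.trans ((norm_add_le _ _).trans_eq ?_)
    rw [hDn, hDkn, two_mul]
  rw [energy, energy, ← integral_const_mul]
  refine integral_mono (integrable_energy ν _ F) ((integrable_energy ν x φ).const_mul 4) fun g => ?_
  have h := pow_le_pow_left₀ (norm_nonneg _) (hpt g) 2
  rw [mul_pow] at h
  norm_num at h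
  exact h

/-- If `|x|` is large, a rotation with `|x - kx| = r₀` brings the frequency down to `r₀`. -/
theorem le_energy_of_unimodular (hd : 2 ≤ d) (ν : Measure (Isom d)) [IsProbabilityMeasure ν]
    {r₀ c₁ : ℝ} (hr₀ : 0 < r₀) (hr₁ : r₀ ≤ 1) (hc₁ : 0 < c₁)
    (hlow : ∀ x : E d, ‖x‖ ≤ r₀ → ∀ φ : L2 d, ‖φ‖ = 1 → c₁ * ‖x‖ ^ 2 ≤ energy ν x φ)
    (x : E d) {φ : L2 d} (hφ : ∀ᵐ ω ∂haarSO d, ‖φ ω‖ = 1) :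
    c₁ * r₀ ^ 2 / 4 * min (‖x‖ ^ 2) 1 ≤ energy ν x φ := by
  have hm0 : 0 ≤ min (‖x‖ ^ 2) 1 := by positivity
  rcases le_total ‖x‖ r₀ with hx | hx
  · refine le_trans ?_ (hlow x hx φ (norm_eq_one_of_ae_norm_eq_one hφ))
    have h1 : r₀ ^ 2 ≤ 1 := pow_le_one₀ hr₀.le hr₁
    have h2 : c₁ * r₀ ^ 2 / 4 ≤ c₁ := by nlinarith
    exact mul_le_mul h2 (min_le_left _ _) hm0 hc₁.le
  · obtain ⟨k, hk⟩ := exists_norm_sub_rotate_eq hd hr₀ hx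
    obtain ⟨F, hF1, hF⟩ := exists_energy_sub_rotate_le ν x k hφ
    have h1 := hlow _ hk.le F hF1
    rw [hk] at h1
    have h2 : c₁ * r₀ ^ 2 / 4 * min (‖x‖ ^ 2) 1 ≤ c₁ * r₀ ^ 2 / 4 :=
      mul_le_of_le_one_right (by positivity) (min_le_right _ _)
    linarith

/-- The function `|φ|`, as an element of `L²(SO(d))`. -/
def absL2 (φ : L2 d) : L2 d := (Lp.memLp φ).norm.ofReal.toLp fun ω => ((‖φ ω‖ : ℝ) : ℂ)

theorem absL2_ae (φ : L2 d) : ∀ᵐ ω ∂haarSO d, absL2 φ ω = (‖φ ω‖ : ℝ) :=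
  MemLp.coeFn_toLp _

theorem norm_absL2 (φ : L2 d) : ‖absL2 φ‖ = ‖φ‖ := by
  rw [absL2, Lp.norm_toLp, Lp.norm_def]
  congr 1
  exact eLpNorm_congr_norm_ae (Filter.Eventually.of_forall fun ω => by simp)

/-- Taking absolute values removes the phases and does not increase the energy. -/
theorem energy_zero_absL2_le (ν : Measure (Isom d)) [IsProbabilityMeasure ν] (x : E d) (φ : L2 d) :
    energy ν 0 (absL2 φ) ≤ energy ν x φ := by
  refine integral_mono (integrable_energy ν _ _) (integrable_energy ν x φ) fun g => ?_
  refine pow_le_pow_left₀ (norm_nonneg _) (Lp.norm_le_norm_of_ae_le ?_) 2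
  filter_upwards [Lp.coeFn_sub (piFun 0 g (absL2 φ)) (absL2 φ), Lp.coeFn_sub (piFun x g φ) φ,
    piFun_ae 0 g (absL2 φ), piFun_ae x g φ, absL2_ae φ,
    (measurePreserving_leftMul g.θ).quasiMeasurePreserving.ae (absL2_ae φ)] with ω h1 h2 h3 h4 h5 h6
  change absL2 φ (g.θ⁻¹ * ω) = (‖φ (g.θ⁻¹ * ω)‖ : ℝ) at h6
  rw [h1, h2, Pi.sub_apply, Pi.sub_apply, h3, h4, h5, h6, rotate_zero, inner_zero_left, e_zero,
    one_mul, ← Complex.ofReal_sub, Complex.norm_real, Real.norm_eq_abs]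
  refine le_trans (le_of_eq ?_) (abs_norm_sub_norm_le _ _)
  rw [norm_mul, norm_e, one_mul]

/-- The unimodular function `φ / |φ|` is as close to `φ` as the constant `1` is to `|φ|`. -/
theorem exists_unimodular (φ : L2 d) : ∃ ψ : L2 d, (∀ᵐ ω ∂haarSO d, ‖ψ ω‖ = 1) ∧
    ‖ψ - φ‖ ≤ ‖absL2 φ - Lp.const 2 (haarSO d) 1‖ := by
  set s : SO d → ℂ := fun ω => if φ ω = 0 then 1 else φ ω / (‖φ ω‖ : ℝ) with hs
  have hφm : Measurable φ := (Lp.stronglyMeasurable φ).measurable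
  have hsm : Measurable s := Measurable.ite (hφm (measurableSet_singleton 0)) measurable_const
    (hφm.div (Complex.measurable_ofReal.comp hφm.norm))
  have hs1 (ω : SO d) : ‖s ω‖ = 1 := by
    by_cases h : φ ω = 0
    · simp [hs, h]
    · simp [hs, h]
  have hdist (ω : SO d) : ‖s ω - φ ω‖ ≤ ‖((‖φ ω‖ : ℝ) : ℂ) - 1‖ := by
    by_cases h : φ ω = 0
    · simp [hs, h]
    · have h0 : ‖φ ω‖ ≠ 0 := norm_ne_zero_iff.2 h
      have h1 : s ω - φ ω = -((((‖φ ω‖ : ℝ) : ℂ) - 1) * s ω) := by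
        have h2 : ((‖φ ω‖ : ℝ) : ℂ) ≠ 0 := by exact_mod_cast h0
        simp only [hs, h, if_false]
        field_simp
        ring
      rw [h1, norm_neg, norm_mul, hs1, mul_one]
  have hmem : MemLp s 2 (haarSO d) := MemLp.of_bound hsm.aestronglyMeasurable 1
    (Filter.Eventually.of_forall fun ω => (hs1 ω).le)
  refine ⟨hmem.toLp s, ?_, Lp.norm_le_norm_of_ae_le ?_⟩
  · filter_upwards [hmem.coeFn_toLp] with ω h
    rw [h, hs1]
  · filter_upwards [hmem.coeFn_toLp, Lp.coeFn_sub (hmem.toLp s) φ,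
      Lp.coeFn_sub (absL2 φ) (Lp.const 2 (haarSO d) 1), absL2_ae φ,
      Lp.coeFn_const (p := 2) (μ := haarSO d) (1 : ℂ)] with ω h1 h2 h3 h4 h5
    rw [h2, h3, Pi.sub_apply, Pi.sub_apply, h1, h4, h5]
    exact hdist ω

theorem energy_le_add_norm_sub (ν : Measure (Isom d)) [IsProbabilityMeasure ν] (x : E d)
    (φ ψ : L2 d) : energy ν x ψ ≤ 2 * energy ν x φ + 8 * ‖ψ - φ‖ ^ 2 := by
  have hi := (integrable_energy ν x φ).const_mul 2
  have h : energy ν x ψ ≤ ∫ g, (2 * ‖piFun x g φ - φ‖ ^ 2 + 8 * ‖ψ - φ‖ ^ 2) ∂ν := by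
    refine integral_mono (integrable_energy ν x ψ) (hi.add (integrable_const _)) fun g => ?_
    have h1 : piFun x g ψ - ψ = (piFun x g φ - φ) + (piFun x g (ψ - φ) - (ψ - φ)) := by
      rw [piFun_sub]
      abel
    have h2 := norm_add_le (piFun x g φ - φ) (piFun x g (ψ - φ) - (ψ - φ))
    have h3 := norm_sub_le (piFun x g (ψ - φ)) (ψ - φ)
    rw [norm_piFun] at h3
    rw [← h1] at h2
    have h4 : ‖piFun x g ψ - ψ‖ ^ 2 ≤ (‖piFun x g φ - φ‖ + 2 * ‖ψ - φ‖) ^ 2 :=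
      pow_le_pow_left₀ (norm_nonneg _) (by linarith) 2
    refine h4.trans ?_
    nlinarith [sq_nonneg (‖piFun x g φ - φ‖ - 2 * ‖ψ - φ‖)]
  refine h.trans_eq ?_
  rw [integral_add hi (integrable_const _), integral_const_mul]
  simp [energy]

/-- By the spectral gap, a function of small energy has almost constant absolute value, and is
therefore close to a unimodular function. -/
theorem exists_le_energy (hd : 2 ≤ d) (ν : Measure (Isom d)) [IsProbabilityMeasure ν]
    {α : ℝ} (hα : 0 < α) (hgap : ∀ φ ∈ L20 d, α * ‖φ‖ ^ 2 ≤ energy ν 0 φ)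
    (hν : ∀ u : E d, ¬ ∀ᵐ g ∂ν, g • u = u) :
    ∃ c : ℝ, 0 < c ∧
      ∀ (x : E d) (φ : L2 d), c * min (‖x‖ ^ 2) 1 * ‖φ‖ ^ 2 ≤ energy ν x φ := by
  obtain ⟨r₀, hr₀, hr₁, c₁, hc₁, hlow⟩ := exists_le_energy_of_norm_le hd ν hα hgap hν
  set c₂ : ℝ := c₁ * r₀ ^ 2 / 4 with hc₂
  have hc₂0 : 0 < c₂ := by positivity
  have hunit (x : E d) (φ : L2 d) (hφ : ‖φ‖ = 1) :
      c₂ / (2 + 32 / α) * min (‖x‖ ^ 2) 1 ≤ energy ν x φ := by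
    obtain ⟨ψ, hψ1, hψ⟩ := exists_unimodular φ
    have h1 := le_energy_of_unimodular hd ν hr₀ hr₁ hc₁ hlow x hψ1
    rw [← hc₂] at h1
    have h2 := energy_le_add_norm_sub ν x φ ψ
    have h3 := (norm_sub_const_mean_sq_le hgap (absL2 φ)).trans (energy_zero_absL2_le ν x φ)
    -- the mean `m` of `|φ|` lies in `[0, 1]`, so `1 - m ≤ ‖|φ| - m‖`
    have h4 : ‖absL2 φ - Lp.const 2 (haarSO d) 1‖ ≤
        2 * ‖absL2 φ - Lp.const 2 (haarSO d) (mean (absL2 φ))‖ := by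
      have hmean : mean (absL2 φ) = ((∫ ω, ‖φ ω‖ ∂haarSO d : ℝ) : ℂ) := by
        rw [mean, integral_congr_ae (absL2_ae φ)]
        exact integral_ofReal
      set m : ℝ := ∫ ω, ‖φ ω‖ ∂haarSO d with hm
      have hm0 : 0 ≤ m := integral_nonneg fun ω => norm_nonneg _
      have hm1 : m ≤ 1 := (integral_norm_le_norm φ).trans_eq hφ
      rw [hmean]
      have h5 := norm_sub_norm_le (absL2 φ) (Lp.const 2 (haarSO d) (m : ℂ))
      rw [norm_absL2, hφ, norm_const, Complex.norm_real, Real.norm_of_nonneg hm0] at h5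
      have h6 := norm_sub_le_norm_sub_add_norm_sub (absL2 φ) (Lp.const 2 (haarSO d) (m : ℂ))
        (Lp.const 2 (haarSO d) 1)
      rw [← map_sub, norm_const, ← Complex.ofReal_one, ← Complex.ofReal_sub, Complex.norm_real,
        Real.norm_of_nonpos (by linarith)] at h6
      simp only [Complex.ofReal_one] at h6
      linarith
    set B : ℝ := ‖absL2 φ - Lp.const 2 (haarSO d) (mean (absL2 φ))‖
    have h7 : ‖ψ - φ‖ ^ 2 ≤ 4 * B ^ 2 := by
      have := pow_le_pow_left₀ (norm_nonneg _) (hψ.trans h4) 2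
      linarith [mul_pow 2 B 2]
    have h8 : B ^ 2 ≤ energy ν x φ / α := by
      rw [le_div_iff₀ hα]
      linarith
    rw [div_mul_eq_mul_div, div_le_iff₀ (by positivity)]
    have h9 : energy ν x φ * (2 + 32 / α) = 2 * energy ν x φ + 32 * (energy ν x φ / α) := by ring
    rw [h9]
    linarith
  refine ⟨c₂ / (2 + 32 / α), by positivity, fun x φ => ?_⟩
  rcases eq_or_ne φ 0 with rfl | hφ
  · simpa using energy_nonneg ν x 0
  have hφ0 : 0 < ‖φ‖ := norm_pos_iff.2 hφ
  have h := hunit x (((‖φ‖⁻¹ : ℝ) : ℂ) • φ) (by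
    rw [norm_smul, Complex.norm_real, norm_inv, norm_norm, inv_mul_cancel₀ hφ0.ne'])
  rw [energy_smul, Complex.norm_real, norm_inv, norm_norm, inv_pow, inv_mul_eq_div,
    le_div_iff₀ (by positivity)] at h
  exact h

end EuclIsom
end
theorem theorem3p1 (d : ℕ) (hd : 3 ≤ d)
    (μ : MeasureTheory.Measure (EuclIsom.Isom d)) [MeasureTheory.IsProbabilityMeasure μ]
    (hsymm : μ.map (fun g => g⁻¹) = μ)
    (hgap : ∃ α : ℝ, 0 < α ∧ ∀ φ ∈ EuclIsom.L20 d,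
      ‖EuclIsom.piMeasure 0 μ φ‖ ≤ (1 - α) * ‖φ‖)
    (hmove : ∀ x : EuclIsom.E d, 0 < μ {g : EuclIsom.Isom d | g • x ≠ x}) :
    ∃ c₀ : ℝ, 0 < c₀ ∧ ∀ x : EuclIsom.E d,
      ‖EuclIsom.piMeasure x μ‖ ≤ 1 - c₀ * min (‖x‖ ^ 2) 1 := by
  obtain ⟨α, hα, hgap⟩ := hgap
  obtain ⟨c, hc, h⟩ := EuclIsom.exists_le_energy (by omega) (EuclIsom.quotientLaw μ) hα
    (EuclIsom.gap_quotientLaw μ hα hgap) (EuclIsom.not_ae_quotientLaw_smul_eq μ hsymm hmove)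
  -- the first bound keeps `1 - c₀ min(|x|², 1)` nonnegative
  refine ⟨min 1 (c / 4), by positivity, fun x => ?_⟩
  have hm0 : 0 ≤ min (‖x‖ ^ 2) 1 := by positivity
  have hm1 : min (‖x‖ ^ 2) 1 ≤ 1 := min_le_right _ _
  have ht0 : 0 ≤ min 1 (c / 4) * min (‖x‖ ^ 2) 1 := by positivity
  have ht1 : min 1 (c / 4) * min (‖x‖ ^ 2) 1 ≤ 1 := mul_le_one₀ (min_le_left _ _) hm0 hm1
  have ht2 : min 1 (c / 4) * min (‖x‖ ^ 2) 1 ≤ c / 4 * min (‖x‖ ^ 2) 1 :=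
    mul_le_mul_of_nonneg_right (min_le_right _ _) hm0
  set t : ℝ := min 1 (c / 4) * min (‖x‖ ^ 2) 1
  refine ContinuousLinearMap.opNorm_le_bound _ (by linarith) fun φ => ?_
  have h1 := h x φ
  rw [EuclIsom.energy_quotientLaw] at h1
  refine (abs_le_of_sq_le_sq' ?_ (mul_nonneg (by linarith) (norm_nonneg φ))).2
  have h2 := mul_le_mul_of_nonneg_right ht2 (sq_nonneg ‖φ‖)
  have h3 : 0 ≤ t ^ 2 * ‖φ‖ ^ 2 := by positivity
  linarith [mul_pow (1 - t) ‖φ‖ 2, show (1 - t) ^ 2 * ‖φ‖ ^ 2 =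
    ‖φ‖ ^ 2 - 2 * (t * ‖φ‖ ^ 2) + t ^ 2 * ‖φ‖ ^ 2 by ring]
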